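/- Let $E$ be a connected, Hausdorff, second countable, finite-dimensional smooth manifold without boundary (for instance an evolution space $E=T^*Q\times\mathbb R$) such that $H_1(E,\mathbb Z)$ is finitely generated. Let $x_0\in E$ and $\hbar>0$. Let $b_1$ be the first Betti number of $E$, that is the rank of $H_1(E,\mathbb Z)$, and let $\mathrm{Tors}\,H_1(E,\mathbb Z)$ be the torsion subgroup. A character is a group homomorphism $\chi:\pi_1(E,x_0)\to U(1)$; the group of characters carries the topology of pointwise convergence. All loops $\gamma$ below are piecewise $C^1$. Then: (1) There is a surjective group homomorphism from the group of characters onto $\mathrm{Tors}\,H_1(E,\mathbb Z)$ whose fibres are exactly the connected components of the group of characters. In particular the components are indexed by $\mathrm{Tors}\,H_1(E,\mathbb Z)$. (2) $H^1_{dR}(E)$ (closed modulo exact smooth real 1-forms) is finite-dimensional, of dimension $b_1$. Every class in $\pi_1(E,x_0)$ is represented by a piecewise $C^1$ loop. (3) Let $\alpha_1,\dots,\alpha_{b_1}$ be closed 1-forms whose classes are a basis of $H^1_{dR}(E)$, and let $(\chi_k)$, $k\in\mathrm{Tors}\,H_1(E,\mathbb Z)$, be any choice of characters such that each connected component of the group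 of characters contains exactly one $\chi_k$. Then every character $\chi$ can be written, for some $k$ and some $a_1,\dots,a_{b_1}\in\mathbb R$, as $$\chi([\gamma])=\exp\Big[\frac{i}{\hbar}\sum_{j=1}^{b_1}a_j\oint_\gamma\alpha_j\Big]\,\chi_k([\gamma])\qquad\text{for all loops }\gamma\text{ at }x_0 .\tag{$*$}$$ Conversely, for all $k$ and $a_1,\dots,a_{b_1}\in\mathbb R$ there is exactly one character $\chi$ satisfying $(*)$, and it lies in the connected component of $\chi_k$ (so $k$ is determined by $\chi$). (4) Call the basis normalised if a closed 1-form has all its loop integrals in $\hbar\mathbb Z$ if and only if its class is an integral linear combination of the classes of the $\alpha_j$. A normalised basis exists, and for a normalised basis the coefficients $a_j$ in $(*)$ are determined by $\chi$ exactly modulo $2\pi$. -/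

import Mathlib

open scoped Manifold ContDiff Topology Bundle

universe u

noncomputable section

/-! ### First homology, Betti number, torsion -/

/-- The first singular homology group `H₁(E, ℤ)`. -/
def H1 (E : Type u) [TopologicalSpace E] : AddCommGrpCat.{u} :=
  ((AlgebraicTopology.singularHomologyFunctor AddCommGrpCat.{u} 1).obj
    (AddCommGrpCat.of (ULift.{u} ℤ))).obj (TopCat.of E)

/-- The first Betti number: the rank of `H₁(E, ℤ)`. -/
def firstBetti (E : Type u) [TopologicalSpace E] : ℕ :=
  Module.finrank ℤ (H1 E)

/-- The torsion subgroup of `H₁(E, ℤ)`. -/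
abbrev TorsH1 (E : Type u) [TopologicalSpace E] : AddSubgroup (H1 E) :=
  AddCommGroup.torsion (H1 E)

/-! ### The group of characters of the fundamental group -/

/-- The characters of `π₁(E, x₀)`: all group homomorphisms to `U(1)`. -/
def Character {E : Type u} [TopologicalSpace E] (x₀ : E) : Type u :=
  FundamentalGroup E x₀ →* Circle

namespace Character

variable {E : Type u} [TopologicalSpace E] {x₀ : E}

instance : CommGroup (Character x₀) :=
  inferInstanceAs (CommGroup (FundamentalGroup E x₀ →* Circle))

instance : FunLike (Character x₀) (FundamentalGroup E x₀) Circle :=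
  inferInstanceAs (FunLike (FundamentalGroup E x₀ →* Circle) (FundamentalGroup E x₀) Circle)

/-- The topology of pointwise convergence (the compact-open topology for the discrete group
`π₁(E, x₀)`). -/
instance : TopologicalSpace (Character x₀) :=
  TopologicalSpace.induced (fun χ g => χ g)
    (inferInstanceAs (TopologicalSpace (FundamentalGroup E x₀ → Circle)))

end Character

/-- The class in `π₁(E, x₀)` of a loop at `x₀`. -/
def loopClass {E : Type u} [TopologicalSpace E] {x₀ : E} (γ : Path x₀ x₀) :
    FundamentalGroup E x₀ :=
  FundamentalGroup.fromPath (Path.Homotopic.Quotient.mk γ)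

/-! ### Differential 1-forms and de Rham cohomology in degree one -/

section Forms

variable {V : Type*} [NormedAddCommGroup V] [NormedSpace ℝ V]
  {H : Type*} [TopologicalSpace H] (I : ModelWithCorners ℝ V H)
  (E : Type u) [TopologicalSpace E] [ChartedSpace H E] [IsManifold I ∞ E]

/-- Smooth real 1-forms on `E`: smooth sections of the cotangent bundle. -/
abbrev OneForm : Type _ :=
  ContMDiffSection I (V →L[ℝ] ℝ) ∞ (fun x : E => TangentSpace I x →L[ℝ] ℝ)

variable {E}

/-- The component along the constant vector `v` of the 1-form `α` in the chart at `x`, that is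
`y ↦ ((φ⁻¹)^* α)_y(v)`, where `φ` is the chart at `x`. -/
def OneForm.inChart (α : OneForm I E) (x : E) (v : V) (y : V) : ℝ :=
  α ((extChartAt I x).symm y)
    (mfderiv 𝓘(ℝ, V) I (extChartAt I x).symm y v)

/-- `α` is closed: in every chart of the given atlas, `dα(u, v) = ∂_u α(v) - ∂_v α(u)` vanishes
for all constant vectors `u`, `v`. -/
def OneForm.IsClosed (α : OneForm I E) : Prop :=
  ∀ x : E, ∀ y ∈ (extChartAt I x).target, ∀ u v : V,
    fderiv ℝ (OneForm.inChart I α x v) y u - fderiv ℝ (OneForm.inChart I α x u) y v = 0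

/-- `α` is exact: `α = df` for a smooth function `f`. -/
def OneForm.IsExact (α : OneForm I E) : Prop :=
  ∃ f : E → ℝ, ContMDiff I 𝓘(ℝ, ℝ) ∞ f ∧
    ∀ (p : E) (v : TangentSpace I p), α p v = mfderiv I 𝓘(ℝ, ℝ) f p v

theorem OneForm.differentiableAt_inChart [I.Boundaryless] (α : OneForm I E) (x : E) (v : V) {y : V}
    (hy : y ∈ (extChartAt I x).target) :
    DifferentiableAt ℝ (OneForm.inChart I α x v) y := by
  have hs : ContMDiffAt 𝓘(ℝ, V) I ∞ (extChartAt I x).symm y :=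
    (contMDiffOn_extChartAt_symm x).contMDiffAt ((isOpen_extChartAt_target x).mem_nhds hy)
  have hα : ContMDiffAt 𝓘(ℝ, V) (I.prod 𝓘(ℝ, V →L[ℝ] ℝ)) ∞
      (fun z => Bundle.TotalSpace.mk' (V →L[ℝ] ℝ) (E := fun p : E => TangentSpace I p →L[ℝ] ℝ)
        ((extChartAt I x).symm z) (α ((extChartAt I x).symm z))) y :=
    (α.contMDiff _).comp y hs
  have hv : ContMDiffAt 𝓘(ℝ, V) (I.prod 𝓘(ℝ, V)) ∞
      (fun z => Bundle.TotalSpace.mk' V (E := fun p : E => TangentSpace I p)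
        ((extChartAt I x).symm z) (mfderiv 𝓘(ℝ, V) I (extChartAt I x).symm z v)) y := by
    have hc : ContMDiffAt 𝓘(ℝ, V) (𝓘(ℝ, V).prod 𝓘(ℝ, V)) ∞
        (fun z : V => Bundle.TotalSpace.mk' V (E := fun p : V => TangentSpace 𝓘(ℝ, V) p) z v) y := by
      rw [Bundle.contMDiffAt_totalSpace]
      refine ⟨contMDiffAt_id, ?_⟩
      simpa using contMDiffAt_const
    have hm := hs.mfderiv_const (m := ∞) (by simp)
    exact ContMDiffAt.clm_apply_of_inCoordinates (b₁ := id)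
      (ϕ := fun z => mfderiv 𝓘(ℝ, V) I (extChartAt I x).symm z) hm hc hs
  have h := hα.clm_bundle_apply (E₂ := Bundle.Trivial E ℝ) hv
  rw [Bundle.contMDiffAt_totalSpace] at h
  exact (h.2.contDiffAt).differentiableAt (by simp)

variable (E)

/-- The real vector space of closed 1-forms. -/
def closedForms [I.Boundaryless] : Submodule ℝ (OneForm I E) where
  carrier := {α | OneForm.IsClosed I α}
  zero_mem' := by
    intro x y hy u v
    have h : ∀ w, OneForm.inChart I (0 : OneForm I E) x w = fun _ => 0 := by
      intro w; funext z; rfl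
    simp [h]
  add_mem' := by
    intro α β hα hβ x y hy u v
    have h : ∀ w, OneForm.inChart I (α + β) x w =
        OneForm.inChart I α x w + OneForm.inChart I β x w := by
      intro w; funext z; rfl
    have hd := fun (η : OneForm I E) w => OneForm.differentiableAt_inChart I η x w hy
    rw [h, h, fderiv_add (hd _ _) (hd _ _), fderiv_add (hd _ _) (hd _ _)]
    have h1 := hα x y hy u v
    have h2 := hβ x y hy u v
    simp only [add_apply]
    linarith
  smul_mem' := by
    intro c α hα x y hy u v
    have h : ∀ w, OneForm.inChart I (c • α) x w = c • OneForm.inChart I α x w := by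
      intro w; funext z; rfl
    have hd := fun (η : OneForm I E) w => OneForm.differentiableAt_inChart I η x w hy
    rw [h, h, fderiv_const_smul (hd _ _), fderiv_const_smul (hd _ _)]
    have h1 := hα x y hy u v
    simp only [smul_apply, smul_eq_mul]
    rw [← mul_sub, h1, mul_zero]

/-- The subspace of exact forms in the space of closed 1-forms. -/
def exactForms [I.Boundaryless] : Submodule ℝ (closedForms I E) where
  carrier := {α | OneForm.IsExact I (α : OneForm I E)}
  zero_mem' := ⟨fun _ => 0, contMDiff_const, by intro p v; rw [mfderiv_const]; rfl⟩
  add_mem' := by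
    rintro α β ⟨f, hf, hfα⟩ ⟨g, hg, hgβ⟩
    refine ⟨f + g, hf.add hg, fun p v => ?_⟩
    have h1 := (hf.mdifferentiable (by simp)) p
    have h2 := (hg.mdifferentiable (by simp)) p
    rw [mfderiv_add h1 h2]
    have e1 := hfα p v
    have e2 := hgβ p v
    exact congrArg₂ (· + ·) e1 e2
  smul_mem' := by
    rintro c α ⟨f, hf, hfα⟩
    refine ⟨c • f, (contMDiff_const (c := c)).mul hf, fun p v => ?_⟩
    have h1 := (hf.mdifferentiable (by simp)) p
    rw [const_smul_mfderiv h1]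
    exact congrArg (c * ·) (hfα p v)

/-- The first de Rham cohomology `H¹_dR(E)`: closed modulo exact 1-forms. -/
abbrev DeRhamH1 [I.Boundaryless] : Type _ := closedForms I E ⧸ exactForms I E

variable {E}

/-- The path `γ` is piecewise continuously differentiable. -/
def IsPiecewiseC1 {x y : E} (γ : Path x y) : Prop :=
  ∃ (n : ℕ) (t : ℕ → ℝ), Monotone t ∧ t 0 = 0 ∧ t n = 1 ∧
    ∀ i < n, ContMDiffOn 𝓘(ℝ, ℝ) I 1 γ.extend (Set.Icc (t i) (t (i + 1)))

/-- The line integral `∫_γ α = ∫₀¹ α_{γ(t)}(γ'(t)) dt`. -/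
def lineIntegral (α : OneForm I E) {x y : E} (γ : Path x y) : ℝ :=
  ∫ t in (0 : ℝ)..1, α (γ.extend t) (mfderiv 𝓘(ℝ, ℝ) I γ.extend t (1 : ℝ))

/-- The family of closed 1-forms `α₁, …, α_b` is normalised with respect to `ħ`: a closed 1-form
has all its loop integrals in `ħ ℤ` if and only if it is cohomologous to an integral linear
combination of the `α_j`. -/
def IsNormalized [I.Boundaryless] (ħ : ℝ) {b : ℕ} (α : Fin b → closedForms I E) : Prop :=
  ∀ β : closedForms I E,
    (∀ (x : E) (γ : Path x x), IsPiecewiseC1 I γ →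
      ∃ m : ℤ, lineIntegral I (β : OneForm I E) γ = ħ * m) ↔
    ∃ m : Fin b → ℤ, (exactForms I E).mkQ β = ∑ j, m j • (exactForms I E).mkQ (α j)

/-- The identity `χ([γ]) = exp[(i/ħ) ∑_j a_j ∮_γ α_j] · ψ([γ])` for every (piecewise `C¹`) loop `γ`
at the base point. -/
def HasForm [I.Boundaryless] (ħ : ℝ) {b : ℕ} (α : Fin b → closedForms I E) {x₀ : E}
    (χ : Character x₀) (a : Fin b → ℝ) (ψ : Character x₀) : Prop :=
  ∀ γ : Path x₀ x₀, IsPiecewiseC1 I γ →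
    (χ (loopClass γ) : ℂ) =
      Complex.exp (Complex.I / (ħ : ℂ) *
        ((∑ j, a j * lineIntegral I (α j : OneForm I E) γ : ℝ) : ℂ)) * (ψ (loopClass γ) : ℂ)

end Forms

end

/-! By the Hurewicz theorem (`hurewicz_surjective`, `hurewicz_ker`) a character is a homomorphism
from `H₁` to `U(1)`, and `H₁` is the direct sum of `ℤ^b₁` and its finite torsion subgroup `T`.
Restriction to `T` maps the characters onto the dual of `T`, which is non-canonically isomorphic to
`T`. The restriction is constant on components, because on a torsion class characters take only
finitely many values. Conversely, two characters with the same restriction differ by `exp(iη)` for a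
real homomorphism `η` on `H₁`, and `t ↦ exp(itη)` joins this factor to `1`. So the components are
exactly the cosets of the image of `Hom(H₁, ℝ)`.

The de Rham theorem in degree one identifies `Hom(H₁, ℝ)` with `H¹_dR`. Both Hurewicz and de Rham
are phrased with path cocycles, that is, functors from the fundamental groupoid to an abelian group.
A closed form gives a real cocycle by continuing local primitives along arbitrary continuous paths;
homotopy invariance comes from lifting to the covering of germs of primitives. If the periods
vanish, integration from the base point gives a global primitive (`ker_period`). Conversely, a
cocycle has local primitives whose differences are locally constant; subtracting their average by a
partition of unity makes them smooth, and their common differential is a closed form with the same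
periods (`period_surjective`).

Since every loop is homotopic to a piecewise `C¹` one, formula (∗) says precisely that `χ` is `χ_k`
times the exponential of `ħ⁻¹ ∑ a_j period(α_j)` (`hasForm_iff`). Spanning gives existence of the
coefficients. They are ambiguous by forms with periods in `2πħℤ`, which for a normalised basis means
by `2πℤ` in each coefficient (`IsNormalized.ofReal_eq_iff`). -/

noncomputable section

/-! ### Additive functionals on homotopy classes of paths -/

/-- A homotopy invariant functional on paths, additive under concatenation: a functor from the
fundamental groupoid to the abelian group `M`. -/
structure PathCocycle (X : Type*) [TopologicalSpace X] (M : Type*) [AddCommGroup M] where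
  /-- the value on a path -/
  val : ∀ {a b : X}, Path a b → M
  val_congr : ∀ {a b : X} {p q : Path a b}, p.Homotopic q → val p = val q
  val_trans : ∀ {a b c : X} (p : Path a b) (q : Path b c), val (p.trans q) = val p + val q

namespace PathCocycle

variable {X : Type*} [TopologicalSpace X] {M : Type*} [AddCommGroup M] (Φ : PathCocycle X M)

@[simp] theorem val_refl (a : X) : Φ.val (Path.refl a) = 0 := by
  have h := Φ.val_trans (Path.refl a) (Path.refl a)
  rw [Path.refl_trans_refl] at h
  simpa using h

@[simp] theorem val_symm {a b : X} (p : Path a b) : Φ.val p.symm = -Φ.val p := by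
  have h := Φ.val_trans p p.symm
  rw [← Φ.val_congr ⟨Path.Homotopy.reflTransSymm p⟩, val_refl] at h
  exact (neg_eq_of_add_eq_zero_right h.symm).symm

@[simp] theorem val_cast {a b a' b' : X} (p : Path a b) (ha : a' = a) (hb : b' = b) :
    Φ.val (p.cast ha hb) = Φ.val p := by
  subst ha hb; rfl

theorem val_subpath_add {a b : X} (p : Path a b) (r s t : unitInterval) :
    Φ.val (p.subpath r s) + Φ.val (p.subpath s t) = Φ.val (p.subpath r t) := by
  rw [← Φ.val_trans]
  exact Φ.val_congr ⟨Path.Homotopy.subpathTransSubpath p r s t⟩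

end PathCocycle

/-- The group law follows the order of composition in the groupoid, opposite to concatenation. The
reversal is harmless later because all targets are commutative. -/
theorem loopClass_trans {X : Type u} [TopologicalSpace X] {x : X} (γ γ' : Path x x) :
    loopClass (γ.trans γ') = loopClass γ' * loopClass γ := rfl

theorem loopClass_surjective {X : Type u} [TopologicalSpace X] {x : X} (g : FundamentalGroup X x) :
    ∃ γ : Path x x, loopClass γ = g :=
  Path.Homotopic.Quotient.mk_surjective g

theorem loopClass_congr {X : Type u} [TopologicalSpace X] {x : X} {γ γ' : Path x x}
    (h : γ.Homotopic γ') : loopClass γ = loopClass γ' :=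
  Path.Homotopic.Quotient.eq.2 h

namespace PathCocycle

/-! ### Passing between the fundamental group and the fundamental groupoid. -/

section Extension

variable {X : Type u} [TopologicalSpace X] {M : Type*} [AddCommGroup M]

/-- The homomorphism on the fundamental group given by a path cocycle. -/
def toHom (Φ : PathCocycle X M) (x₀ : X) : FundamentalGroup X x₀ →* Multiplicative M where
  toFun g := Quotient.lift (fun p : Path x₀ x₀ => Multiplicative.ofAdd (Φ.val p))
    (fun _ _ h => congrArg _ (Φ.val_congr h)) g
  map_one' := congrArg Multiplicative.ofAdd (Φ.val_refl x₀)
  map_mul' g h := by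
    obtain ⟨γ, rfl⟩ := loopClass_surjective g
    obtain ⟨γ', rfl⟩ := loopClass_surjective h
    rw [← loopClass_trans]
    change Multiplicative.ofAdd (Φ.val (γ'.trans γ)) = Multiplicative.ofAdd (Φ.val γ + Φ.val γ')
    rw [Φ.val_trans, add_comm]

@[simp] theorem toHom_loopClass (Φ : PathCocycle X M) {x₀ : X} (γ : Path x₀ x₀) :
    Φ.toHom x₀ (loopClass γ) = Multiplicative.ofAdd (Φ.val γ) := rfl

variable [PathConnectedSpace X] {x₀ : X}

open PathConnectedSpace (somePath)

/-- Close a path up to a loop at `x₀`, along chosen paths to its end points. -/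
def closeUp (x₀ : X) {a b : X} (p : Path a b) : Path x₀ x₀ :=
  ((somePath x₀ a).trans p).trans (somePath x₀ b).symm

/-- The chosen path to the intermediate point is traversed back and forth, and cancels. -/
theorem closeUp_trans {a b c : X} (p : Path a b) (q : Path b c) :
    loopClass (closeUp x₀ (p.trans q)) = loopClass (closeUp x₀ q) * loopClass (closeUp x₀ p) := by
  have key : ∀ {y : X} (α : Path.Homotopic.Quotient x₀ a) (p : Path.Homotopic.Quotient a b)
      (q : Path.Homotopic.Quotient b c) (β : Path.Homotopic.Quotient x₀ b)
      (δ : Path.Homotopic.Quotient c y), (α.trans (p.trans q)).trans δ =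
        ((α.trans p).trans β.symm).trans ((β.trans q).trans δ) := by
    intro y α p q β δ
    simp only [Path.Homotopic.Quotient.trans_assoc]
    rw [← Path.Homotopic.Quotient.trans_assoc β.symm, Path.Homotopic.Quotient.symm_trans,
      Path.Homotopic.Quotient.refl_trans]
  exact key (.mk (somePath x₀ a)) (.mk p) (.mk q) (.mk (somePath x₀ b)) (.symm (.mk (somePath x₀ c)))

/-- A homomorphism from the fundamental group to an abelian group extends to the fundamental
groupoid. -/
def ofHom (φ : FundamentalGroup X x₀ →* Multiplicative M) : PathCocycle X M where
  val p := (φ (loopClass (closeUp x₀ p))).toAdd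
  val_congr h := by
    rw [loopClass_congr]
    exact ((Path.Homotopic.refl _).hcomp h).hcomp (Path.Homotopic.refl _)
  val_trans p q := by
    rw [closeUp_trans, map_mul, toAdd_mul, add_comm]

/-- The chosen path from `x₀` to itself need not be constant, so closing up conjugates the loop; a
commutative target does not see this. -/
theorem ofHom_val_loop (φ : FundamentalGroup X x₀ →* Multiplicative M) (γ : Path x₀ x₀) :
    (ofHom φ).val γ = (φ (loopClass γ)).toAdd := by
  refine congrArg Multiplicative.toAdd (?_ : φ (loopClass (closeUp x₀ γ)) = φ (loopClass γ))
  have h : loopClass (closeUp x₀ γ) =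
      (loopClass (somePath x₀ x₀))⁻¹ * (loopClass γ * loopClass (somePath x₀ x₀)) := rfl
  rw [h, map_mul, map_mul, map_inv, mul_comm, mul_inv_cancel_right]

end Extension

end PathCocycle
end

noncomputable section

/-! ### Low-dimensional singular simplices -/

namespace SingularSimplex

variable {X : Type u} [TopologicalSpace X]

/-- The `i`-th barycentric coordinate. -/
def coord {n : ℕ} (i : Fin n) : C(stdSimplex ℝ (Fin n), unitInterval) :=
  ⟨fun s => ⟨s i, stdSimplex.zero_le s i, stdSimplex.le_one s i⟩,
    ((continuous_apply i).comp continuous_subtype_val).subtype_mk _⟩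

/-- The inclusion of the `i`-th face of the standard simplex. -/
def face {n : ℕ} (i : Fin (n + 2)) :
    C(stdSimplex ℝ (Fin (n + 1)), stdSimplex ℝ (Fin (n + 2))) :=
  ⟨stdSimplex.map (Fin.succAbove i), stdSimplex.continuous_map _⟩

theorem face_apply_succAbove {n : ℕ} (i : Fin (n + 2)) (s : stdSimplex ℝ (Fin (n + 1)))
    (j : Fin (n + 1)) : face i s (i.succAbove j) = s j := by
  change (FunOnFinite.linearMap ℝ ℝ i.succAbove ⇑s) (i.succAbove j) = s j
  rw [FunOnFinite.linearMap_apply_apply, Finset.sum_eq_single j]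
  · intro k hk hkj
    simp only [Finset.mem_filter, Finset.mem_univ, true_and] at hk
    exact absurd (Fin.succAbove_right_injective hk) hkj
  · simp

theorem face_apply_self {n : ℕ} (i : Fin (n + 2)) (s : stdSimplex ℝ (Fin (n + 1))) :
    face i s i = 0 := by
  change (FunOnFinite.linearMap ℝ ℝ i.succAbove ⇑s) i = 0
  rw [FunOnFinite.linearMap_apply_apply]
  apply Finset.sum_eq_zero
  intro k hk
  simp only [Finset.mem_filter, Finset.mem_univ, true_and] at hk
  exact absurd hk (Fin.succAbove_ne i k)

@[simp] theorem face_zero_zero (s : stdSimplex ℝ (Fin 2)) : face 0 s 0 = 0 := face_apply_self 0 s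
@[simp] theorem face_zero_one (s : stdSimplex ℝ (Fin 2)) : face 0 s 1 = s 0 :=
  face_apply_succAbove 0 s 0
@[simp] theorem face_zero_two (s : stdSimplex ℝ (Fin 2)) : face 0 s 2 = s 1 :=
  face_apply_succAbove 0 s 1
@[simp] theorem face_one_zero (s : stdSimplex ℝ (Fin 2)) : face 1 s 0 = s 0 :=
  face_apply_succAbove 1 s 0
@[simp] theorem face_one_one (s : stdSimplex ℝ (Fin 2)) : face 1 s 1 = 0 := face_apply_self 1 s
@[simp] theorem face_one_two (s : stdSimplex ℝ (Fin 2)) : face 1 s 2 = s 1 :=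
  face_apply_succAbove 1 s 1
@[simp] theorem face_two_zero (s : stdSimplex ℝ (Fin 2)) : face 2 s 0 = s 0 :=
  face_apply_succAbove 2 s 0
@[simp] theorem face_two_one (s : stdSimplex ℝ (Fin 2)) : face 2 s 1 = s 1 :=
  face_apply_succAbove 2 s 1
@[simp] theorem face_two_two (s : stdSimplex ℝ (Fin 2)) : face 2 s 2 = 0 := face_apply_self 2 s

/-- The point of the standard 1-simplex with parameter `t`. -/
def ofUnitInterval : C(unitInterval, stdSimplex ℝ (Fin 2)) :=
  ⟨fun t => ⟨![1 - t, t], by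
      refine ⟨fun i => ?_, by simp [Fin.sum_univ_two]⟩
      fin_cases i
      · simpa using t.2.2
      · simpa using t.2.1⟩, by
    refine Continuous.subtype_mk (continuous_pi fun i => ?_) _
    fin_cases i
    · exact continuous_const.sub continuous_subtype_val
    · exact continuous_subtype_val⟩

@[simp] theorem ofUnitInterval_zero (t : unitInterval) : ofUnitInterval t 0 = 1 - t := rfl
@[simp] theorem ofUnitInterval_one (t : unitInterval) : ofUnitInterval t 1 = t := rfl

/-- A path as a singular 1-simplex. -/
def ofPath {a b : X} (p : Path a b) : C(stdSimplex ℝ (Fin 2), X) := p.toContinuousMap.comp (coord 1)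

/-- A singular 1-simplex as a path. -/
def toPath (σ : C(stdSimplex ℝ (Fin 2), X)) : Path (σ (ofUnitInterval 0)) (σ (ofUnitInterval 1)) where
  toContinuousMap := σ.comp ofUnitInterval
  source' := rfl
  target' := rfl

theorem ofPath_toPath (σ : C(stdSimplex ℝ (Fin 2), X)) : ofPath (toPath σ) = σ := by
  ext s
  change σ (ofUnitInterval (coord 1 s)) = σ s
  congr 1
  ext i
  have := stdSimplex.add_eq_one s
  fin_cases i
  · change 1 - s 1 = s 0
    linarith
  · rfl

theorem toPath_ofPath {a b : X} (p : Path a b) :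
    ∃ (ha : ofPath p (ofUnitInterval 0) = a) (hb : ofPath p (ofUnitInterval 1) = b),
      toPath (ofPath p) = p.cast ha hb := by
  refine ⟨?_, ?_, ?_⟩
  · exact (congrArg p (Subtype.ext rfl : coord 1 (ofUnitInterval 0) = 0)).trans p.source
  · exact (congrArg p (Subtype.ext rfl : coord 1 (ofUnitInterval 1) = 1)).trans p.target
  · ext t
    rfl

/-- The 2-simplex exhibiting a concatenation. -/
def transSimplex {a b c : X} (p : Path a b) (q : Path b c) : C(stdSimplex ℝ (Fin 3), X) :=
  (p.trans q).toContinuousMap.comp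
    -- The affine function with values `0`, `1/2`, `1` at the three vertices, so that the outer
    -- edges run through the two halves of the concatenation.
    ⟨fun s => ⟨s 1 / 2 + s 2, by
        have h := stdSimplex.sum_eq_one s
        rw [Fin.sum_univ_three] at h
        have h0 := stdSimplex.zero_le s 0
        have h1 := stdSimplex.zero_le s 1
        have h2 := stdSimplex.zero_le s 2
        constructor <;> linarith⟩, by
      refine Continuous.subtype_mk ?_ _
      exact ((continuous_subtype_val.comp (coord 1).continuous).div_const 2).add
        (continuous_subtype_val.comp (coord 2).continuous)⟩

theorem transSimplex_face_zero {a b c : X} (p : Path a b) (q : Path b c) :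
    (transSimplex p q).comp (face 0) = ofPath q := by
  ext s
  have h0 := stdSimplex.zero_le s 0
  have h1 := stdSimplex.zero_le s 1
  have h := stdSimplex.add_eq_one s
  simp only [transSimplex, ofPath, ContinuousMap.comp_apply, ContinuousMap.coe_mk, face_zero_one,
    face_zero_two]
  change p.trans q _ = q _
  rw [Path.trans_apply]
  split_ifs with hs
  -- On this edge the parameter is at least `1/2`, so only the junction point remains in this case.
  · have hs0 : s 1 = 0 := by
      change s 0 / 2 + s 1 ≤ 1 / 2 at hs
      linarith
    have hs1 : s 0 = 1 := by linarith
    trans b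
    · refine Eq.trans (congrArg p (Subtype.ext ?_)) p.target
      change 2 * (s 0 / 2 + s 1) = 1
      rw [hs0, hs1]; norm_num
    · exact (Eq.trans (congrArg q (Subtype.ext hs0)) q.source).symm
  · congr 1
    ext
    change 2 * (s 0 / 2 + s 1) - 1 = s 1
    linarith

theorem transSimplex_face_two {a b c : X} (p : Path a b) (q : Path b c) :
    (transSimplex p q).comp (face 2) = ofPath p := by
  ext s
  have h0 := stdSimplex.zero_le s 0
  have h1 := stdSimplex.le_one s 1
  simp only [transSimplex, ofPath, ContinuousMap.comp_apply, ContinuousMap.coe_mk, face_two_one,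
    face_two_two]
  change p.trans q _ = p _
  rw [Path.trans_apply, dif_pos (by change s 1 / 2 + 0 ≤ 1 / 2; linarith)]
  congr 1
  ext
  change 2 * (s 1 / 2 + 0) = s 1
  ring

theorem transSimplex_face_one {a b c : X} (p : Path a b) (q : Path b c) :
    (transSimplex p q).comp (face 1) = ofPath (p.trans q) := by
  ext s
  simp only [transSimplex, ofPath, ContinuousMap.comp_apply, ContinuousMap.coe_mk, face_one_one,
    face_one_two]
  congr 1
  ext
  change 0 / 2 + s 1 = s 1
  ring

/-- The sum of two barycentric coordinates of the 2-simplex. -/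
def addCoord : C(stdSimplex ℝ (Fin 3), unitInterval) :=
  ⟨fun s => ⟨s 1 + s 2, by
      have h := stdSimplex.sum_eq_one s
      rw [Fin.sum_univ_three] at h
      have h0 := stdSimplex.zero_le s 0
      have h1 := stdSimplex.zero_le s 1
      have h2 := stdSimplex.zero_le s 2
      constructor <;> linarith⟩, by
    refine Continuous.subtype_mk ?_ _
    exact (continuous_subtype_val.comp (coord 1).continuous).add
      (continuous_subtype_val.comp (coord 2).continuous)⟩

/-- The triangle of the unit square with vertices `(0,0)`, `(0,1)`, `(1,1)`. -/
def lowerTriangle : C(stdSimplex ℝ (Fin 3), unitInterval × unitInterval) := (coord 2).prodMk addCoord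

/-- The triangle of the unit square with vertices `(0,0)`, `(1,0)`, `(1,1)`. -/
def upperTriangle : C(stdSimplex ℝ (Fin 3), unitInterval × unitInterval) := addCoord.prodMk (coord 2)

/-- The diagonal of a homotopy. -/
def diagonal {a b : X} {p q : Path a b} (F : p.Homotopy q) : Path a b where
  toFun t := F (t, t)
  continuous_toFun := by fun_prop
  source' := by simp
  target' := by simp

theorem addCoord_face_zero (s : stdSimplex ℝ (Fin 2)) : addCoord (face 0 s) = 1 := by
  apply Subtype.ext; change face 0 s 1 + face 0 s 2 = 1; simpa using stdSimplex.add_eq_one s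
theorem addCoord_face_one (s : stdSimplex ℝ (Fin 2)) : addCoord (face 1 s) = coord 1 s := by
  apply Subtype.ext; change face 1 s 1 + face 1 s 2 = s 1; simp
theorem addCoord_face_two (s : stdSimplex ℝ (Fin 2)) : addCoord (face 2 s) = coord 1 s := by
  apply Subtype.ext; change face 2 s 1 + face 2 s 2 = s 1; simp
theorem coord_face_zero (s : stdSimplex ℝ (Fin 2)) : coord 2 (face 0 s) = coord 1 s := by
  apply Subtype.ext; change face 0 s 2 = s 1; simp
theorem coord_face_one (s : stdSimplex ℝ (Fin 2)) : coord 2 (face 1 s) = coord 1 s := by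
  apply Subtype.ext; change face 1 s 2 = s 1; simp
theorem coord_face_two (s : stdSimplex ℝ (Fin 2)) : coord 2 (face 2 s) = 0 := by
  apply Subtype.ext; change face 2 s 2 = 0; simp

variable {a b : X} {p q : Path a b} (F : p.Homotopy q)

theorem lower_face_zero : ((F : C(unitInterval × unitInterval, X)).comp lowerTriangle).comp (face 0) = ofPath (Path.refl b) := by
  ext s
  change F (coord 2 (face 0 s), addCoord (face 0 s)) = b
  rw [addCoord_face_zero, F.target]

theorem lower_face_one : ((F : C(unitInterval × unitInterval, X)).comp lowerTriangle).comp (face 1) = ofPath (diagonal F) := by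
  ext s
  change F (coord 2 (face 1 s), addCoord (face 1 s)) = F (coord 1 s, coord 1 s)
  rw [addCoord_face_one, coord_face_one]

theorem lower_face_two : ((F : C(unitInterval × unitInterval, X)).comp lowerTriangle).comp (face 2) = ofPath p := by
  ext s
  change F (coord 2 (face 2 s), addCoord (face 2 s)) = p (coord 1 s)
  rw [addCoord_face_two, coord_face_two]
  simp

theorem upper_face_zero : ((F : C(unitInterval × unitInterval, X)).comp upperTriangle).comp (face 0) = ofPath q := by
  ext s
  change F (addCoord (face 0 s), coord 2 (face 0 s)) = q (coord 1 s)
  rw [addCoord_face_zero, coord_face_zero]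
  simp

theorem upper_face_one : ((F : C(unitInterval × unitInterval, X)).comp upperTriangle).comp (face 1) = ofPath (diagonal F) := by
  ext s
  change F (addCoord (face 1 s), coord 2 (face 1 s)) = F (coord 1 s, coord 1 s)
  rw [addCoord_face_one, coord_face_one]

theorem upper_face_two : ((F : C(unitInterval × unitInterval, X)).comp upperTriangle).comp (face 2) = ofPath (Path.refl a) := by
  ext s
  change F (addCoord (face 2 s), coord 2 (face 2 s)) = a
  rw [coord_face_two, F.source]

/-- A path cocycle sums to zero along the boundary of a singular 2-simplex. -/
theorem cocycle_boundary {M : Type*} [AddCommGroup M] (Φ : PathCocycle X M)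
    (τ : C(stdSimplex ℝ (Fin 3), X)) :
    Φ.val (toPath (τ.comp (face 0))) - Φ.val (toPath (τ.comp (face 1))) +
      Φ.val (toPath (τ.comp (face 2))) = 0 := by
  have : ContractibleSpace (stdSimplex ℝ (Fin 3)) :=
    (convex_stdSimplex ℝ (Fin 3)).contractibleSpace ⟨_, single_mem_stdSimplex ℝ (0 : Fin 3)⟩
  have e01 : face 2 (ofUnitInterval 1) = face 0 (ofUnitInterval 0) := by
    ext i; fin_cases i <;> simp
  have e02 : face 1 (ofUnitInterval 0) = face 2 (ofUnitInterval 0) := by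
    ext i; fin_cases i <;> simp
  have e12 : face 1 (ofUnitInterval 1) = face 0 (ofUnitInterval 1) := by
    ext i; fin_cases i <;> simp
  let P2 := toPath (face (n := 1) 2)
  let P0 := (toPath (face (n := 1) 0)).cast e01 rfl
  let P1 := (toPath (face (n := 1) 1)).cast e02.symm e12.symm
  -- The simplex is contractible, so going along two edges is homotopic to going along the third;
  -- `τ` carries the homotopy to `X`.
  have h := (SimplyConnectedSpace.paths_homotopic (P2.trans P0) P1).map τ
  have h' := Φ.val_congr h
  rw [Path.map_trans, Φ.val_trans] at h'
  have h0 : Φ.val (P0.map τ.continuous) = Φ.val (toPath (τ.comp (face 0))) :=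
    Φ.val_cast (toPath (τ.comp (face 0))) (congrArg τ e01) rfl
  have h1 : Φ.val (P1.map τ.continuous) = Φ.val (toPath (τ.comp (face 1))) :=
    Φ.val_cast (toPath (τ.comp (face 1))) (congrArg τ e02.symm) (congrArg τ e12.symm)
  have h2 : Φ.val (P2.map τ.continuous) = Φ.val (toPath (τ.comp (face 2))) := rfl
  rw [h0, h1, h2] at h'
  rw [← h']
  abel

end SingularSimplex
end

noncomputable section

/-! ### Singular chains and the Hurewicz homomorphism -/

namespace SingularSimplex

open CategoryTheory Simplicial

variable {X : Type u} [TopologicalSpace X]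

/-- The coefficient group `ℤ`. -/
abbrev coeffs : AddCommGrpCat.{u} := AddCommGrpCat.of (ULift.{u} ℤ)

variable (X) in
/-- The singular chain complex with integral coefficients. -/
abbrev chains : ChainComplex AddCommGrpCat.{u} ℕ :=
  (TopCat.toSSet.obj (TopCat.of X)).chainComplex coeffs.{u}

/-- A singular simplex as an element of the singular simplicial set. -/
def toSSetSimplex {n : ℕ} (σ : C(stdSimplex ℝ (Fin (n + 1)), X)) :
    (TopCat.toSSet.obj (TopCat.of X)) _⦋n⦌ :=
  (TopCat.toSSetObjEquiv (TopCat.of X) (.op ⦋n⦌)).symm σ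

theorem toSSetSimplex_surjective {n : ℕ} (x : (TopCat.toSSet.obj (TopCat.of X)) _⦋n⦌) :
    ∃ σ, toSSetSimplex σ = x :=
  (TopCat.toSSetObjEquiv (TopCat.of X) (.op ⦋n⦌)).symm.surjective x

theorem δ_toSSetSimplex {n : ℕ} (i : Fin (n + 2)) (τ : C(stdSimplex ℝ (Fin (n + 2)), X)) :
    (TopCat.toSSet.obj (TopCat.of X)).δ i (toSSetSimplex (n := n + 1) τ) =
      toSSetSimplex (τ.comp (face i)) := rfl

/-- The elementary chain of a singular simplex. -/
def chain {n : ℕ} (σ : C(stdSimplex ℝ (Fin (n + 1)), X)) : (chains X).X n :=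
  ((TopCat.toSSet.obj (TopCat.of X)).ιChainComplex (R := coeffs.{u}) (toSSetSimplex σ)).hom ⟨1⟩

/-- Chains are a coproduct of copies of `ℤ`, one for each simplex, and a homomorphism from `ℤ` is
determined at `1`. -/
theorem chains_hom_ext {n : ℕ} {T : AddCommGrpCat.{u}} {f g : (chains X).X n ⟶ T}
    (h : ∀ σ : C(stdSimplex ℝ (Fin (n + 1)), X), f.hom (chain σ) = g.hom (chain σ)) : f = g := by
  apply SSet.chainComplex_hom_ext
  intro x
  obtain ⟨σ, rfl⟩ := toSSetSimplex_surjective x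
  ext ⟨m⟩
  have hm : (⟨m⟩ : ULift.{u} ℤ) = m • (⟨1⟩ : ULift.{u} ℤ) := by
    ext; simp
  change (((TopCat.toSSet.obj (TopCat.of X)).ιChainComplex (toSSetSimplex σ)) ≫ f).hom (⟨m⟩ : ULift.{u} ℤ) =
    (((TopCat.toSSet.obj (TopCat.of X)).ιChainComplex (toSSetSimplex σ)) ≫ g).hom (⟨m⟩ : ULift.{u} ℤ)
  rw [hm, map_zsmul, map_zsmul]
  exact congrArg (m • ·) (h σ)

/-- The homomorphism on chains with given values on simplices. -/
def chainsLift {n : ℕ} {T : AddCommGrpCat.{u}} (f : C(stdSimplex ℝ (Fin (n + 1)), X) → T) :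
    (chains X).X n ⟶ T :=
  ((TopCat.toSSet.obj (TopCat.of X)).isColimitChainComplexXCofan coeffs.{u} n).desc
    (Limits.Cofan.mk T fun x => AddCommGrpCat.ofHom
      (((zmultiplesHom T) (f (TopCat.toSSetObjEquiv (TopCat.of X) (.op ⦋n⦌) x))).comp
        AddEquiv.ulift.toAddMonoidHom))

theorem chainsLift_chain {n : ℕ} {T : AddCommGrpCat.{u}}
    (f : C(stdSimplex ℝ (Fin (n + 1)), X) → T) (σ : C(stdSimplex ℝ (Fin (n + 1)), X)) :
    (chainsLift f).hom (chain σ) = f σ := by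
  have h := ((TopCat.toSSet.obj (TopCat.of X)).isColimitChainComplexXCofan coeffs.{u} n).fac
    (Limits.Cofan.mk T fun x => AddCommGrpCat.ofHom
      (((zmultiplesHom T) (f (TopCat.toSSetObjEquiv (TopCat.of X) (.op ⦋n⦌) x))).comp
        AddEquiv.ulift.toAddMonoidHom)) ⟨toSSetSimplex σ⟩
  have h' := congrArg (fun φ => (AddCommGrpCat.Hom.hom φ) (⟨1⟩ : ULift.{u} ℤ)) h
  refine h'.trans ?_
  change (1 : ℤ) • f _ = _
  rw [one_smul]
  rfl

theorem d_chain_two (τ : C(stdSimplex ℝ (Fin 3), X)) :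
    ((chains X).d 2 1).hom (chain (n := 2) τ) =
      chain (τ.comp (face 0)) - chain (τ.comp (face 1)) + chain (τ.comp (face 2)) := by
  have h := (TopCat.toSSet.obj (TopCat.of X)).ιChainComplex_d coeffs.{u} (toSSetSimplex (n := 2) τ)
  have h' := congrArg (fun φ => (AddCommGrpCat.Hom.hom φ) (⟨1⟩ : ULift.{u} ℤ)) h
  refine h'.trans ?_
  rw [Fin.sum_univ_three]
  simp only [δ_toSSetSimplex]
  simp [chain, sub_eq_add_neg]

theorem d_chain_one (τ : C(stdSimplex ℝ (Fin 2), X)) :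
    ((chains X).d 1 0).hom (chain (n := 1) τ) =
      chain (n := 0) (τ.comp (face 0)) - chain (n := 0) (τ.comp (face 1)) := by
  have h := (TopCat.toSSet.obj (TopCat.of X)).ιChainComplex_d coeffs.{u} (toSSetSimplex (n := 1) τ)
  have h' := congrArg (fun φ => (AddCommGrpCat.Hom.hom φ) (⟨1⟩ : ULift.{u} ℤ)) h
  refine h'.trans ?_
  rw [Fin.sum_univ_two]
  simp only [δ_toSSetSimplex]
  simp [chain, sub_eq_add_neg]

/-- The class of a singular 1-simplex modulo boundaries. -/
def opclass (σ : C(stdSimplex ℝ (Fin 2), X)) : (chains X).opcycles 1 :=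
  ((chains X).pOpcycles 1).hom (chain (n := 1) σ)

theorem opclass_boundary (τ : C(stdSimplex ℝ (Fin 3), X)) :
    opclass (τ.comp (face 0)) - opclass (τ.comp (face 1)) + opclass (τ.comp (face 2)) = 0 := by
  have h := congrArg (fun φ => (AddCommGrpCat.Hom.hom φ) (chain (n := 2) τ))
    ((chains X).d_pOpcycles 2 1)
  have h' : ((chains X).pOpcycles 1).hom (((chains X).d 2 1).hom (chain (n := 2) τ)) = 0 := h
  rw [d_chain_two, map_add, map_sub] at h'
  exact h'

/-- The boundary of `transSimplex p q` is `q - p.trans q + p`. -/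
theorem opclass_trans {a b c : X} (p : Path a b) (q : Path b c) :
    opclass (ofPath (p.trans q)) = opclass (ofPath p) + opclass (ofPath q) := by
  have h := opclass_boundary (transSimplex p q)
  rw [transSimplex_face_zero, transSimplex_face_one, transSimplex_face_two] at h
  rw [← sub_eq_zero, ← neg_eq_zero, ← h]
  abel

theorem opclass_refl (a : X) : opclass (ofPath (Path.refl a)) = 0 := by
  have h := opclass_trans (Path.refl a) (Path.refl a)
  rw [Path.refl_trans_refl] at h
  simpa using h

/-- Cut the square of the homotopy along its diagonal. Up to constant sides, which have class zero,
the two triangles show that `p` and `q` both have the class of the diagonal. -/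
theorem opclass_congr {a b : X} {p q : Path a b} (h : p.Homotopic q) :
    opclass (ofPath p) = opclass (ofPath q) := by
  obtain ⟨F⟩ := h
  have h1 := opclass_boundary ((F : C(unitInterval × unitInterval, X)).comp lowerTriangle)
  have h2 := opclass_boundary ((F : C(unitInterval × unitInterval, X)).comp upperTriangle)
  rw [lower_face_zero, lower_face_one, lower_face_two, opclass_refl] at h1
  rw [upper_face_zero, upper_face_one, upper_face_two, opclass_refl] at h2
  rw [← sub_eq_zero, ← h1.trans h2.symm |> sub_eq_zero.2]
  abel

variable (X) in
/-- Paths modulo boundaries of singular 2-simplices. -/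
def opclassCocycle : PathCocycle X ((chains X).opcycles 1) where
  val p := opclass (ofPath p)
  val_congr h := opclass_congr h
  val_trans p q := opclass_trans p q

/-- The inclusion of homology into chains modulo boundaries. -/
def homologyToOpcycles : H1 X →+ (chains X).opcycles 1 := ((chains X).homologyι 1).hom

theorem homologyToOpcycles_injective : Function.Injective (homologyToOpcycles (X := X)) :=
  (AddCommGrpCat.mono_iff_injective _).1 inferInstance

/-- Homology is the kernel of the map induced by the differential on chains modulo boundaries. -/
theorem exists_homologyToOpcycles_eq {w : (chains X).opcycles 1}
    (hw : ((chains X).fromOpcycles 1 0).hom w = 0) :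
    ∃ z : H1 X, homologyToOpcycles z = w := by
  let S : ShortComplex AddCommGrpCat.{u} :=
    ShortComplex.mk ((chains X).homologyι 1) ((chains X).fromOpcycles 1 0)
      ((chains X).homologyι_comp_fromOpcycles 1 0)
  have hS : S.Exact := ShortComplex.exact_of_f_is_kernel S
    ((chains X).homologyIsKernel 1 0 (by simp))
  exact (ShortComplex.ab_exact_iff S).1 hS w hw

theorem fromOpcycles_opclass (σ : C(stdSimplex ℝ (Fin 2), X)) :
    ((chains X).fromOpcycles 1 0).hom (opclass σ) =
      chain (n := 0) (σ.comp (face 0)) - chain (n := 0) (σ.comp (face 1)) := by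
  rw [← d_chain_one]
  exact congrArg (fun φ => (AddCommGrpCat.Hom.hom φ) (chain (n := 1) σ))
    ((chains X).p_fromOpcycles 1 0)

/-- A point as a singular 0-simplex. -/
def ofPoint (x : X) : C(stdSimplex ℝ (Fin 1), X) := .const _ x

theorem comp_face_zero_eq (σ : C(stdSimplex ℝ (Fin 2), X)) :
    σ.comp (face (n := 0) 0) = ofPoint (σ (ofUnitInterval 1)) := by
  ext s
  change σ _ = σ _
  congr 1
  ext i
  fin_cases i
  · simpa using face_apply_self (n := 0) 0 s
  · simpa using (face_apply_succAbove (n := 0) 0 s 0).trans (stdSimplex.eq_one_of_unique (X := Fin 1) s 0)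

theorem comp_face_one_eq (σ : C(stdSimplex ℝ (Fin 2), X)) :
    σ.comp (face (n := 0) 1) = ofPoint (σ (ofUnitInterval 0)) := by
  ext s
  change σ _ = σ _
  congr 1
  ext i
  fin_cases i
  · simpa using (face_apply_succAbove (n := 0) 1 s 0).trans (stdSimplex.eq_one_of_unique (X := Fin 1) s 0)
  · simpa using face_apply_self (n := 0) 1 s

theorem exists_homologyToOpcycles_eq_toHom (x₀ : X) (g : FundamentalGroup X x₀) :
    ∃ z : H1 X, homologyToOpcycles z = ((opclassCocycle X).toHom x₀ g).toAdd := by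
  obtain ⟨γ, rfl⟩ := loopClass_surjective g
  apply exists_homologyToOpcycles_eq
  obtain ⟨ha, hb, -⟩ := toPath_ofPath γ
  refine (fromOpcycles_opclass (ofPath γ)).trans ?_
  rw [comp_face_zero_eq, comp_face_one_eq, ha, hb, sub_self]

/-- The Hurewicz homomorphism. -/
def hurewicz (x₀ : X) : FundamentalGroup X x₀ →* Multiplicative (H1 X) where
  toFun g := Multiplicative.ofAdd (exists_homologyToOpcycles_eq_toHom x₀ g).choose
  -- Preimages under `homologyToOpcycles` are unique, so both laws may be checked modulo boundaries.
  map_one' := by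
    refine congrArg Multiplicative.ofAdd (?_ : _ = (0 : H1 X))
    apply homologyToOpcycles_injective
    rw [(exists_homologyToOpcycles_eq_toHom x₀ 1).choose_spec, map_one, map_zero, toAdd_one]
  map_mul' g h := by
    rw [← ofAdd_add]
    apply congrArg Multiplicative.ofAdd
    apply homologyToOpcycles_injective
    rw [(exists_homologyToOpcycles_eq_toHom x₀ (g * h)).choose_spec, map_mul, map_add,
      (exists_homologyToOpcycles_eq_toHom x₀ g).choose_spec, (exists_homologyToOpcycles_eq_toHom x₀ h).choose_spec]
    rfl

theorem homologyToOpcycles_hurewicz (x₀ : X) (g : FundamentalGroup X x₀) :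
    homologyToOpcycles (hurewicz x₀ g).toAdd =
      ((opclassCocycle X).toHom x₀ g).toAdd :=
  (exists_homologyToOpcycles_eq_toHom x₀ g).choose_spec

variable [PathConnectedSpace X]

/-- The abelianization map extends to a path cocycle, hence to a homomorphism on 1-chains, which
kills boundaries by `cocycle_boundary`. It therefore descends to chains modulo boundaries and
recovers the abelianized class of a loop from its homology class. -/
theorem hurewicz_ker (x₀ : X) : (hurewicz x₀).ker ≤ commutator (FundamentalGroup X x₀) := by
  intro g hg
  let φ : FundamentalGroup X x₀ →*
      Multiplicative (Additive (Abelianization (FundamentalGroup X x₀))) := Abelianization.of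
  let Φ : PathCocycle X (Additive (Abelianization (FundamentalGroup X x₀))) :=
    PathCocycle.ofHom (x₀ := x₀) φ
  let θ : (chains X).X 1 ⟶ AddCommGrpCat.of (Additive (Abelianization (FundamentalGroup X x₀))) :=
    chainsLift fun σ => Φ.val (toPath σ)
  have hθ : (chains X).d 2 1 ≫ θ = 0 := by
    apply chains_hom_ext
    intro τ
    change θ.hom (((chains X).d 2 1).hom (chain (n := 2) τ)) = 0
    rw [d_chain_two, map_add, map_sub, chainsLift_chain, chainsLift_chain, chainsLift_chain]
    exact cocycle_boundary Φ τ
  let Θ := (chains X).descOpcycles θ 2 (by simp) hθ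
  have hΘ (σ : C(stdSimplex ℝ (Fin 2), X)) : Θ.hom (opclass σ) = Φ.val (toPath σ) := by
    refine Eq.trans ?_ (chainsLift_chain (T := AddCommGrpCat.of (Additive (Abelianization (FundamentalGroup X x₀))))
       (fun σ => Φ.val (toPath σ)) σ)
    exact congrArg (fun φ => (AddCommGrpCat.Hom.hom φ) (chain (n := 1) σ))
      ((chains X).p_descOpcycles θ 2 (by simp) hθ)
  obtain ⟨γ, rfl⟩ := loopClass_surjective g
  have h := homologyToOpcycles_hurewicz x₀ (loopClass γ)
  rw [MonoidHom.mem_ker.1 hg, toAdd_one, map_zero] at h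
  have h2 : Θ.hom (opclass (ofPath γ)) = 0 := by
    rw [show opclass (ofPath γ) = 0 from h.symm, map_zero]
  obtain ⟨ha, hb, hγ⟩ := toPath_ofPath γ
  rw [hΘ, hγ, Φ.val_cast] at h2
  have h3 := (PathCocycle.ofHom_val_loop φ γ).symm.trans h2
  rw [← Abelianization.ker_of]
  exact h3

open PathConnectedSpace (somePath) in
-- Modulo boundaries, a 1-simplex is its closed-up loop plus the difference of the chosen paths to
-- its end points. The correction is a function of the boundary, so it disappears for a cycle.
theorem hurewicz_surjective (x₀ : X) : Function.Surjective (hurewicz x₀) := by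
  intro z
  let hab : Additive (Abelianization (FundamentalGroup X x₀)) →+ H1 X :=
    MonoidHom.toAdditiveLeft (Abelianization.lift (hurewicz x₀))
  let A : (chains X).X 1 ⟶ AddCommGrpCat.of (Additive (Abelianization (FundamentalGroup X x₀))) :=
    chainsLift fun σ => Additive.ofMul (Abelianization.of
      (loopClass (PathCocycle.closeUp x₀ (toPath σ))))
  let L : (chains X).X 0 ⟶ (chains X).opcycles 1 :=
    chainsLift fun s => (opclassCocycle X).val (somePath x₀ (s default))
  -- `A` closes simplices up to loops and `L` sends a point to the chosen path leading to it; the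
  -- identity need only be checked on simplices.
  have key : (chains X).pOpcycles 1 =
      A ≫ AddCommGrpCat.ofHom hab ≫ (chains X).homologyι 1 + (chains X).d 1 0 ≫ L := by
    apply chains_hom_ext
    intro σ
    change opclass σ = homologyToOpcycles (hab (A.hom (chain (n := 1) σ))) +
      L.hom (((chains X).d 1 0).hom (chain (n := 1) σ))
    have hA : A.hom (chain (n := 1) σ) = Additive.ofMul (Abelianization.of
      (loopClass (PathCocycle.closeUp x₀ (toPath σ)))) := chainsLift_chain _ σ
    rw [d_chain_one, map_sub, chainsLift_chain, chainsLift_chain, hA,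
      comp_face_zero_eq, comp_face_one_eq]
    have h1 := homologyToOpcycles_hurewicz x₀ (loopClass (PathCocycle.closeUp x₀ (toPath σ)))
    have h2 : opclass σ = (opclassCocycle X).val (toPath σ) := by
      change _ = opclass (ofPath (toPath σ))
      rw [ofPath_toPath]
    have h3 : hab (Additive.ofMul (Abelianization.of
        (loopClass (PathCocycle.closeUp x₀ (toPath σ))))) =
        (hurewicz x₀ (loopClass (PathCocycle.closeUp x₀ (toPath σ)))).toAdd := rfl
    rw [h3, h1, PathCocycle.toHom_loopClass, toAdd_ofAdd, PathCocycle.closeUp,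
      PathCocycle.val_trans, PathCocycle.val_trans, PathCocycle.val_symm, h2]
    change _ = _ + ((opclassCocycle X).val (somePath x₀ (σ (ofUnitInterval 1))) -
      (opclassCocycle X).val (somePath x₀ (σ (ofUnitInterval 0))))
    abel
  have hp : Function.Surjective ((chains X).pOpcycles 1).hom :=
    (AddCommGrpCat.epi_iff_surjective _).1 inferInstance
  obtain ⟨c, hc⟩ := hp (homologyToOpcycles z.toAdd)
  have hd : ((chains X).d 1 0).hom c = 0 := by
    have h1 := congrArg (fun φ => (AddCommGrpCat.Hom.hom φ) c) ((chains X).p_fromOpcycles 1 0)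
    have h2 := congrArg (fun φ => (AddCommGrpCat.Hom.hom φ) z.toAdd)
      ((chains X).homologyι_comp_fromOpcycles 1 0)
    exact h1.symm.trans ((congrArg ((chains X).fromOpcycles 1 0).hom hc).trans h2)
  have h := congrArg (fun φ => (AddCommGrpCat.Hom.hom φ) c) key
  have h' : ((chains X).pOpcycles 1).hom c = homologyToOpcycles (hab (A.hom c)) +
    L.hom (((chains X).d 1 0).hom c) := h
  rw [hd, map_zero, add_zero, hc] at h'
  have hz := homologyToOpcycles_injective h'
  obtain ⟨g, hg⟩ := QuotientGroup.mk_surjective (A.hom c).toMul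
  refine ⟨g, ?_⟩
  have : z = Multiplicative.ofAdd (hab (A.hom c)) := hz
  rw [this]
  change _ = Abelianization.lift (hurewicz x₀) (A.hom c).toMul
  rw [← hg]
  rfl

end SingularSimplex
end

noncomputable section

/-! ### Integration of locally exact data along continuous paths -/

/-- A family of local primitives on a space: functions `f x` defined near `x`, any two of which
differ by a locally constant function on the overlap of their domains. -/
structure PrimitiveSystem (X : Type*) [TopologicalSpace X] where
  /-- the domains -/
  U : X → Set X
  isOpen_U : ∀ x, IsOpen (U x)
  mem_U : ∀ x, x ∈ U x
  /-- the local primitives -/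
  f : X → X → ℝ
  compat : ∀ x x' y, y ∈ U x → y ∈ U x' → ∀ᶠ z in 𝓝 y, f x z - f x' z = f x y - f x' y

namespace PrimitiveSystem

variable {X : Type*} [TopologicalSpace X] (P : PrimitiveSystem X)
  {T : Type*} [TopologicalSpace T]

/-- The function `g` is a primitive along the map `s`. -/
def IsPrimitive (s : T → X) (g : T → ℝ) : Prop :=
  ∀ t x, s t ∈ P.U x → ∀ᶠ t' in 𝓝 t, g t' - P.f x (s t') = g t - P.f x (s t)

variable {P}

theorem isPrimitive_of_exists {s : T → X} (hs : Continuous s) {g : T → ℝ}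
    (h : ∀ t, ∃ x, s t ∈ P.U x ∧ ∀ᶠ t' in 𝓝 t, g t' - P.f x (s t') = g t - P.f x (s t)) :
    P.IsPrimitive s g := by
  intro t x hx
  obtain ⟨x', hx', h'⟩ := h t
  filter_upwards [h', hs.continuousAt.eventually (P.compat x' x (s t) hx' hx)] with t' h1 h2
  linarith

theorem IsPrimitive.comp {s : T → X} {g : T → ℝ} (h : P.IsPrimitive s g) {T' : Type*}
    [TopologicalSpace T'] {k : T' → T} (hk : Continuous k) :
    P.IsPrimitive (s ∘ k) (g ∘ k) :=
  fun t x hx => hk.continuousAt.eventually (h (k t) x hx)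

/-- The difference of two primitives along the same map is locally constant. -/
theorem IsPrimitive.sub_eq [PreconnectedSpace T] {s : T → X} {g g' : T → ℝ}
    (h : P.IsPrimitive s g) (h' : P.IsPrimitive s g') (t t₀ : T) :
    g t - g t₀ = g' t - g' t₀ := by
  have hl : IsLocallyConstant fun t => g t - g' t := by
    rw [IsLocallyConstant.iff_eventually_eq]
    intro t
    filter_upwards [h t _ (P.mem_U _), h' t _ (P.mem_U _)] with t' h1 h2
    linarith
  have := hl.apply_eq_of_preconnectedSpace t t₀
  linarith

theorem isPrimitive_comp_f {s : T → X} (hs : Continuous s) {x : X} (hx : ∀ t, s t ∈ P.U x) :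
    P.IsPrimitive s (fun t => P.f x (s t)) :=
  isPrimitive_of_exists hs fun t => ⟨x, hx t, Filter.Eventually.of_forall fun t' => by simp⟩

/-- The real numbers with the discrete topology. -/
def DiscreteReal : Type := ℝ

instance : TopologicalSpace DiscreteReal := ⊥
instance : DiscreteTopology DiscreteReal := ⟨rfl⟩

variable (P) in
/-- The covering of germs of primitives. -/
def bundleCore : FiberBundleCore X X DiscreteReal where
  baseSet := P.U
  isOpen_baseSet := P.isOpen_U
  indexAt := id
  mem_baseSet_at := P.mem_U
  -- A coordinate `v` in the trivialization `i` stands for the germ of `f i + (constant v)`; the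
  -- formula keeps `v + f i y` unchanged.
  coordChange i j y v := (show ℝ from v) + (P.f i y - P.f j y)
  coordChange_self i x _ v := by
    change (show ℝ from v) + (P.f i x - P.f i x) = v
    rw [sub_self]
    exact add_zero (show ℝ from v)
  continuousOn_coordChange i j := by
    rintro ⟨y, v⟩ ⟨⟨hi, hj⟩, -⟩
    apply ContinuousAt.continuousWithinAt
    refine Filter.Tendsto.congr' ?_ tendsto_const_nhds
    -- The fibre is discrete and the difference of primitives is locally constant, so the coordinate
    -- change is constant near `(y, v)`.
    have h1 : ∀ᶠ p : X × DiscreteReal in 𝓝 (y, v), P.f i p.1 - P.f j p.1 = P.f i y - P.f j y :=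
      (continuous_fst.tendsto (y, v)).eventually (P.compat i j y hi hj)
    have h2 : ∀ᶠ p : X × DiscreteReal in 𝓝 (y, v), p.2 = v :=
      (continuous_snd.tendsto (y, v)).eventually (p := fun w => w = v)
        (by rw [nhds_discrete]; exact Filter.eventually_pure.2 rfl)
    filter_upwards [h1, h2] with p hp1 hp2
    rw [hp2, hp1]
  coordChange_comp i j k x _ v := by
    change ((show ℝ from v) + (P.f i x - P.f j x)) + (P.f j x - P.f k x) =
      (show ℝ from v) + (P.f i x - P.f k x)
    ring

theorem isCoveringMap_proj : IsCoveringMap P.bundleCore.proj :=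
  FiberBundle.isCoveringMap (F := DiscreteReal) (E := P.bundleCore.Fiber)

/-- The value of a point of the covering. -/
def coveringValue (e : P.bundleCore.TotalSpace) : ℝ := (show ℝ from e.2) + P.f e.1 e.1

/-- In each trivialization the fibre coordinate of a lift is a continuous function to a discrete
space, hence locally constant; it is the value of the lift minus the local primitive. -/
theorem isPrimitive_of_lift {s : T → X} (L : C(T, P.bundleCore.TotalSpace))
    (hL : P.bundleCore.proj ∘ L = s) : P.IsPrimitive s (fun t => coveringValue (L t)) := by
  intro t x hx
  have hs : ∀ t, (L t).1 = s t := fun t => congrFun hL t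
  have hsrc : L t ∈ (P.bundleCore.localTriv x).source := by
    rw [FiberBundleCore.mem_localTriv_source, ← FiberBundleCore.baseSet_at]
    exact (hs t).symm ▸ hx
  have hc : ContinuousAt (fun t' => ((P.bundleCore.localTriv x) (L t')).2) t :=
    continuous_snd.continuousAt.comp
      (((P.bundleCore.localTriv x).continuousAt hsrc).comp L.continuous.continuousAt)
  have hev : ∀ᶠ t' in 𝓝 t, ((P.bundleCore.localTriv x) (L t')).2 =
      ((P.bundleCore.localTriv x) (L t)).2 := by
    have h := hc.tendsto
    rw [nhds_discrete DiscreteReal, Filter.tendsto_pure] at h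
    exact h
  have hval : ∀ t', (show ℝ from ((P.bundleCore.localTriv x) (L t')).2) =
      coveringValue (L t') - P.f x (s t') := by
    intro t'
    rw [← hs t']
    change (show ℝ from (L t').2) + (P.f (L t').1 (L t').1 - P.f x (L t').1) =
      (show ℝ from (L t').2) + P.f (L t').1 (L t').1 - P.f x (L t').1
    ring
  filter_upwards [hev] with t' h'
  rw [← hval, ← hval]
  exact h'

variable (P) in
theorem exists_isPrimitive_path (s : C(unitInterval, X)) : ∃ g, P.IsPrimitive s g :=
  ⟨_, isPrimitive_of_lift _ ((isCoveringMap_proj (P := P)).liftPath_lifts s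
    ⟨s 0, (show DiscreteReal from (0 : ℝ))⟩ rfl)⟩

variable (P) in
-- Lift the edge with first coordinate `0`, then apply homotopy lifting to the whole square.
theorem exists_isPrimitive_square (s : C(unitInterval × unitInterval, X)) :
    ∃ g, P.IsPrimitive s g := by
  let b : C(unitInterval, X) := s.comp ((ContinuousMap.const _ 0).prodMk (.id _))
  let e : P.bundleCore.TotalSpace := ⟨b 0, (show DiscreteReal from (0 : ℝ))⟩
  have hb := (isCoveringMap_proj (P := P)).liftPath_lifts b e rfl
  exact ⟨_, isPrimitive_of_lift _ ((isCoveringMap_proj (P := P)).liftHomotopy_lifts s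
    ((isCoveringMap_proj (P := P)).liftPath b e rfl) (fun a => (congrFun hb a).symm))⟩

/-- The increment of a primitive along a path. -/
def pathVal {a b : X} (p : Path a b) : ℝ :=
  (P.exists_isPrimitive_path p.toContinuousMap).choose 1 -
    (P.exists_isPrimitive_path p.toContinuousMap).choose 0

theorem pathVal_eq {a b : X} (p : Path a b) {g : unitInterval → ℝ} (hg : P.IsPrimitive p g) :
    P.pathVal p = g 1 - g 0 :=
  IsPrimitive.sub_eq (P.exists_isPrimitive_path p.toContinuousMap).choose_spec hg 1 0

/-- A primitive along the whole homotopy restricts to primitives along `p` and `q`. It is constant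
on the two sides where the end points stay fixed, so its increments agree. -/
theorem pathVal_congr {a b : X} {p q : Path a b} (h : p.Homotopic q) :
    P.pathVal p = P.pathVal q := by
  obtain ⟨F⟩ := h
  obtain ⟨g, hg⟩ := P.exists_isPrimitive_square (F : C(unitInterval × unitInterval, X))
  have hp : P.IsPrimitive p fun t => g (0, t) := by
    have := hg.comp (Continuous.prodMk_right (Y := unitInterval) (0 : unitInterval))
    convert this using 1
    · funext t
      exact (F.apply_zero t).symm
    · rfl
  have hq : P.IsPrimitive q fun t => g (1, t) := by
    have := hg.comp (Continuous.prodMk_right (Y := unitInterval) (1 : unitInterval))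
    convert this using 1
    · funext t
      exact (F.apply_one t).symm
    · rfl
  have side : ∀ (t : unitInterval) (c : X), (∀ r, F (r, t) = c) → g (1, t) - g (0, t) = 0 := by
    intro t c hc
    have h1 : P.IsPrimitive (fun _ : unitInterval => c) fun r => g (r, t) := by
      have := hg.comp (Continuous.prodMk_left (X := unitInterval) t)
      convert this using 1
      · funext r
        exact (hc r).symm
      · rfl
    have h2 : P.IsPrimitive (fun _ : unitInterval => c) fun _ => (0 : ℝ) :=
      fun _ _ _ => Filter.Eventually.of_forall fun _ => rfl
    simpa using h1.sub_eq h2 1 0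
  have h0 := side 0 a F.source
  have h1 := side 1 b F.target
  rw [pathVal_eq p hp, pathVal_eq q hq]
  linarith

theorem pathVal_trans {a b c : X} (p : Path a b) (q : Path b c) :
    P.pathVal (p.trans q) = P.pathVal p + P.pathVal q := by
  obtain ⟨g, hg⟩ := P.exists_isPrimitive_path (p.trans q).toContinuousMap
  -- The two halves of the parameter interval: a primitive along the concatenation pulls back to
  -- primitives along `p` and `q`.
  let k₁ : unitInterval → unitInterval := fun t =>
    ⟨t / 2, by constructor <;> linarith [t.2.1, t.2.2]⟩
  let k₂ : unitInterval → unitInterval := fun t =>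
    ⟨(1 + t) / 2, by constructor <;> linarith [t.2.1, t.2.2]⟩
  have hk₁ : Continuous k₁ := (continuous_subtype_val.div_const 2).subtype_mk _
  have hk₂ : Continuous k₂ := ((continuous_const.add continuous_subtype_val).div_const 2).subtype_mk _
  have hp : P.IsPrimitive p (g ∘ k₁) := by
    have := hg.comp hk₁
    convert this using 1
    funext t
    change p t = (p.trans q) (k₁ t)
    rw [Path.trans_apply, dif_pos (show (t : ℝ) / 2 ≤ 1 / 2 by linarith [t.2.2])]
    congr 1
    ext
    change (t : ℝ) = 2 * (t / 2)
    ring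
  have hq : P.IsPrimitive q (g ∘ k₂) := by
    have := hg.comp hk₂
    convert this using 1
    funext t
    change q t = (p.trans q) (k₂ t)
    rw [Path.trans_apply]
    split_ifs with h
    · have ht : t = 0 := by
        ext
        change (1 + (t : ℝ)) / 2 ≤ 1 / 2 at h
        have := t.2.1
        change (t : ℝ) = 0
        linarith
      subst ht
      rw [q.source]
      refine (Eq.trans (congrArg p (Subtype.ext ?_)) p.target).symm
      change 2 * ((1 + (0 : ℝ)) / 2) = 1
      norm_num
    · congr 1
      ext
      change (t : ℝ) = 2 * ((1 + t) / 2) - 1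
      ring
  rw [pathVal_eq _ hg, pathVal_eq p hp, pathVal_eq q hq]
  have e1 : k₁ 1 = k₂ 0 := by
    ext; change (1 : ℝ) / 2 = (1 + 0) / 2; norm_num
  have e2 : k₁ 0 = 0 := by
    ext; change (0 : ℝ) / 2 = 0; norm_num
  have e3 : k₂ 1 = 1 := by
    ext; change (1 + (1 : ℝ)) / 2 = 1; norm_num
  simp only [Function.comp_apply, e1, e2, e3]
  ring

variable (P) in
/-- Integration of a system of local primitives along paths. -/
def integral : PathCocycle X ℝ where
  val p := P.pathVal p
  val_congr h := pathVal_congr h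
  val_trans p q := pathVal_trans p q

theorem integral_val_eq {a b : X} (p : Path a b) {g : unitInterval → ℝ} (hg : P.IsPrimitive p g) :
    P.integral.val p = g 1 - g 0 :=
  pathVal_eq p hg

theorem integral_val_of_mem {a b : X} (p : Path a b) {x : X} (hp : ∀ t, p t ∈ P.U x) :
    P.integral.val p = P.f x b - P.f x a := by
  rw [integral_val_eq p (isPrimitive_comp_f p.continuous hp), p.source, p.target]

end PrimitiveSystem

/-- A path cocycle whose values on small paths are increments of given local primitives, is
integration of these primitives. -/
theorem PrimitiveSystem.integral_val_eq_of_local {X : Type*} [TopologicalSpace X]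
    (P : PrimitiveSystem X) (Φ : PathCocycle X ℝ)
    (hΦ : ∀ (x : X) {a b : X} (p : Path a b), (∀ t, p t ∈ P.U x) →
      Φ.val p = P.f x b - P.f x a) {a b : X} (p : Path a b) :
    P.integral.val p = Φ.val p := by
  -- The values of `Φ` on initial segments of `p` form a primitive along `p`, because short segments
  -- stay in one domain of `P`.
  have hg : P.IsPrimitive p fun t => Φ.val (p.subpath 0 t) := by
    apply isPrimitive_of_exists p.continuous
    intro t
    refine ⟨p t, P.mem_U _, ?_⟩
    have hnhds : p ⁻¹' P.U (p t) ∈ 𝓝 t :=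
      p.continuous.continuousAt.preimage_mem_nhds ((P.isOpen_U _).mem_nhds (P.mem_U _))
    obtain ⟨l, u, ht, hVn, hV⟩ := exists_Icc_mem_subset_of_mem_nhds hnhds
    filter_upwards [hVn] with t' ht'
    have h1 : ∀ r, (p.subpath t t') r ∈ P.U (p t) := by
      intro r
      have : (p.subpath t t') r ∈ Set.range (p.subpath t t') := ⟨r, rfl⟩
      rw [Path.range_subpath] at this
      obtain ⟨r', hr', hr⟩ := this
      rw [← hr]
      exact hV (Set.uIcc_subset_Icc ht ht' hr')
    have h2 := hΦ (p t) _ h1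
    have h3 := Φ.val_subpath_add p 0 t t'
    linarith
  have h1 := PrimitiveSystem.integral_val_eq p hg
  rw [h1, Path.subpath_self, Φ.val_refl, sub_zero, Path.subpath_zero_one, Φ.val_cast]

end

noncomputable section

/-! ### Chart balls and the Poincaré lemma -/

section ChartBall

variable {V : Type*} [NormedAddCommGroup V] [NormedSpace ℝ V]
  {H : Type*} [TopologicalSpace H] (I : ModelWithCorners ℝ V H) [I.Boundaryless]
  {E : Type u} [TopologicalSpace E] [ChartedSpace H E]

theorem exists_ball_subset_target (x : E) :
    ∃ r > 0, Metric.ball (extChartAt I x x) r ⊆ (extChartAt I x).target :=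
  Metric.mem_nhds_iff.1 ((isOpen_extChartAt_target x).mem_nhds (mem_extChartAt_target x))

/-- A ball in the target of the chart at `x`. -/
def modelBall (x : E) : Set V :=
  Metric.ball (extChartAt I x x) (exists_ball_subset_target I x).choose

/-- The corresponding neighbourhood of `x`. -/
def chartBall (x : E) : Set E := (extChartAt I x).source ∩ extChartAt I x ⁻¹' modelBall I x

theorem modelBall_subset (x : E) : modelBall I x ⊆ (extChartAt I x).target :=
  (exists_ball_subset_target I x).choose_spec.2

theorem isOpen_modelBall (x : E) : IsOpen (modelBall I x) := Metric.isOpen_ball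

theorem convex_modelBall (x : E) : Convex ℝ (modelBall I x) := convex_ball _ _

theorem isOpen_chartBall (x : E) : IsOpen (chartBall I x) :=
  (continuousOn_extChartAt x).isOpen_inter_preimage (isOpen_extChartAt_source x)
    (isOpen_modelBall I x)

theorem mem_chartBall (x : E) : x ∈ chartBall I x :=
  ⟨mem_extChartAt_source x, Metric.mem_ball_self (exists_ball_subset_target I x).choose_spec.1⟩

theorem symm_mem_chartBall {x : E} {y : V} (hy : y ∈ modelBall I x) :
    (extChartAt I x).symm y ∈ chartBall I x :=
  ⟨(extChartAt I x).map_target (modelBall_subset I x hy), by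
    rwa [Set.mem_preimage, (extChartAt I x).right_inv (modelBall_subset I x hy)]⟩

/-- Seen in the chart, both paths run in a convex set, which is simply connected. -/
theorem homotopic_of_mem_chartBall {x a b : E} (p q : Path a b) (hp : ∀ t, p t ∈ chartBall I x)
    (hq : ∀ t, q t ∈ chartBall I x) : p.Homotopic q := by
  have ha : a ∈ chartBall I x := by simpa using hp 0
  have hb : b ∈ chartBall I x := by simpa using hp 1
  have : ContractibleSpace (modelBall I x) :=
    (convex_modelBall I x).contractibleSpace ⟨_, ha.2⟩
  let ψ : C(modelBall I x, E) := ⟨fun y => (extChartAt I x).symm y,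
    ((continuousOn_extChartAt_symm x).mono (modelBall_subset I x)).domRestrict⟩
  let lift : ∀ r : Path a b, (∀ t, r t ∈ chartBall I x) →
      Path (⟨_, ha.2⟩ : modelBall I x) ⟨_, hb.2⟩ := fun r hr =>
    { toFun := fun t => ⟨extChartAt I x (r t), (hr t).2⟩
      continuous_toFun := by
        refine Continuous.subtype_mk ?_ _
        exact (continuousOn_extChartAt x).comp_continuous r.continuous fun t => (hr t).1
      source' := by simp
      target' := by simp }
  have hlift : ∀ (r : Path a b) (hr : ∀ t, r t ∈ chartBall I x),
      r = ((lift r hr).map ψ.continuous).cast ((extChartAt I x).left_inv ha.1).symm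
        ((extChartAt I x).left_inv hb.1).symm := by
    intro r hr
    ext t
    exact ((extChartAt I x).left_inv (hr t).1).symm
  rw [hlift p hp, hlift q hq]
  exact ((SimplyConnectedSpace.paths_homotopic _ _).map ψ).pathCast _ _

theorem exists_lineMap_mem_modelBall {x a b : E} (ha : a ∈ chartBall I x) (hb : b ∈ chartBall I x)
    {t : ℝ} (ht : t ∈ Set.Icc (0 : ℝ) 1) :
    AffineMap.lineMap (extChartAt I x a) (extChartAt I x b) t ∈ modelBall I x :=
  (convex_modelBall I x).lineMap_mem ha.2 hb.2 ht

/-- The path which is a straight line in the chart at `x`. -/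
def chartSegment {x a b : E} (ha : a ∈ chartBall I x) (hb : b ∈ chartBall I x) : Path a b where
  toFun t := (extChartAt I x).symm (AffineMap.lineMap (extChartAt I x a) (extChartAt I x b) (t : ℝ))
  continuous_toFun := by
    refine (continuousOn_extChartAt_symm x).comp_continuous ?_ fun t =>
      modelBall_subset I x (exists_lineMap_mem_modelBall I ha hb t.2)
    exact AffineMap.lineMap_continuous.comp continuous_subtype_val
  source' := by
    simpa only [Set.Icc.coe_zero, AffineMap.lineMap_apply_zero] using
      (extChartAt I x).left_inv ha.1
  target' := by
    simpa only [Set.Icc.coe_one, AffineMap.lineMap_apply_one] using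
      (extChartAt I x).left_inv hb.1

theorem chartSegment_mem {x a b : E} (ha : a ∈ chartBall I x) (hb : b ∈ chartBall I x)
    (t : unitInterval) : chartSegment I ha hb t ∈ chartBall I x :=
  symm_mem_chartBall I (exists_lineMap_mem_modelBall I ha hb t.2)

variable [IsManifold I ∞ E]

theorem mfderiv_symm_comp_extChartAt {x p : E} (hp : p ∈ (extChartAt I x).source)
    (v : TangentSpace I p) :
    mfderiv 𝓘(ℝ, V) I (extChartAt I x).symm (extChartAt I x p)
      (mfderiv I 𝓘(ℝ, V) (extChartAt I x) p v) = v := by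
  have : IsManifold I 1 E := .of_le (n := ∞) (by simp)
  have h := mfderivWithin_extChartAt_symm_comp_mfderiv_extChartAt' (I := I) hp
  rw [I.range_eq_univ, mfderivWithin_univ] at h
  exact DFunLike.congr_fun h v

theorem contMDiffAt_extChartAt_symm {x : E} {y : V} (hy : y ∈ (extChartAt I x).target) :
    ContMDiffAt 𝓘(ℝ, V) I ∞ (extChartAt I x).symm y :=
  (contMDiffOn_extChartAt_symm x).contMDiffAt ((isOpen_extChartAt_target x).mem_nhds hy)

variable {I} in
-- The component is the pairing of two smooth sections along the inverse chart: the form, and the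
-- image of a constant vector field.
theorem OneForm.contDiffAt_inChart (α : OneForm I E) (x : E) (v : V) {y : V}
    (hy : y ∈ (extChartAt I x).target) :
    ContDiffAt ℝ ∞ (OneForm.inChart I α x v) y := by
  have hs : ContMDiffAt 𝓘(ℝ, V) I ∞ (extChartAt I x).symm y := contMDiffAt_extChartAt_symm I hy
  have hα : ContMDiffAt 𝓘(ℝ, V) (I.prod 𝓘(ℝ, V →L[ℝ] ℝ)) ∞
      (fun z => Bundle.TotalSpace.mk' (V →L[ℝ] ℝ) (E := fun p : E => TangentSpace I p →L[ℝ] ℝ)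
        ((extChartAt I x).symm z) (α ((extChartAt I x).symm z))) y :=
    (α.contMDiff _).comp y hs
  have hv : ContMDiffAt 𝓘(ℝ, V) (I.prod 𝓘(ℝ, V)) ∞
      (fun z => Bundle.TotalSpace.mk' V (E := fun p : E => TangentSpace I p)
        ((extChartAt I x).symm z) (mfderiv 𝓘(ℝ, V) I (extChartAt I x).symm z v)) y := by
    have hc : ContMDiffAt 𝓘(ℝ, V) (𝓘(ℝ, V).prod 𝓘(ℝ, V)) ∞
        (fun z : V => Bundle.TotalSpace.mk' V (E := fun p : V => TangentSpace 𝓘(ℝ, V) p) z v) y := by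
      rw [Bundle.contMDiffAt_totalSpace]
      refine ⟨contMDiffAt_id, ?_⟩
      simpa using contMDiffAt_const
    have hm := hs.mfderiv_const (m := ∞) (by simp)
    exact ContMDiffAt.clm_apply_of_inCoordinates (b₁ := id)
      (ϕ := fun z => mfderiv 𝓘(ℝ, V) I (extChartAt I x).symm z) hm hc hs
  have h := hα.clm_bundle_apply (E₂ := Bundle.Trivial E ℝ) hv
  rw [Bundle.contMDiffAt_totalSpace] at h
  exact h.2.contDiffAt

/-- In a small ball of the chart the derivative vanishes identically, and a ball is connected. -/
theorem eventually_eq_of_mfderiv_eq_zero {f : E → ℝ} {p : E}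
    (hf : ∀ᶠ q in 𝓝 p, MDifferentiableAt I 𝓘(ℝ, ℝ) f q ∧ mfderiv I 𝓘(ℝ, ℝ) f q = 0) :
    ∀ᶠ q in 𝓝 p, f q = f p := by
  have hsymm : ContinuousAt (extChartAt I p).symm (extChartAt I p p) :=
    continuousAt_extChartAt_symm p
  have h1 : ∀ᶠ y in 𝓝 (extChartAt I p p), (MDifferentiableAt I 𝓘(ℝ, ℝ) f ((extChartAt I p).symm y) ∧
      mfderiv I 𝓘(ℝ, ℝ) f ((extChartAt I p).symm y) = 0) ∧ y ∈ modelBall I p := by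
    refine Filter.Eventually.and ?_ ((isOpen_modelBall I p).mem_nhds (mem_chartBall I p).2)
    have h := hsymm.tendsto
    rw [extChartAt_to_inv] at h
    exact h.eventually hf
  obtain ⟨r, hr, hball⟩ := Metric.mem_nhds_iff.1 h1
  have hd : ∀ y ∈ Metric.ball (extChartAt I p p) r,
      HasFDerivAt (f ∘ (extChartAt I p).symm) (0 : V →L[ℝ] ℝ) y := by
    intro y hy
    obtain ⟨⟨h2, h3⟩, h4⟩ := hball hy
    have hs := (contMDiffAt_extChartAt_symm I (modelBall_subset I p h4)).mdifferentiableAt (by simp)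
    have h5 := (h2.hasMFDerivAt.comp y hs.hasMFDerivAt).hasFDerivAt
    rw [h3] at h5
    exact h5
  have hconst : ∀ y ∈ Metric.ball (extChartAt I p p) r,
      (f ∘ (extChartAt I p).symm) y = (f ∘ (extChartAt I p).symm) (extChartAt I p p) :=
    fun y hy => Metric.isOpen_ball.is_const_of_fderiv_eq_zero (convex_ball _ _).isPreconnected
      (fun z hz => (hd z hz).differentiableAt.differentiableWithinAt)
      (fun z hz => (hd z hz).fderiv) hy (Metric.mem_ball_self hr)
  have h6 : ∀ᶠ q in 𝓝 p, extChartAt I p q ∈ Metric.ball (extChartAt I p p) r ∧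
      q ∈ (extChartAt I p).source :=
    ((continuousAt_extChartAt p).eventually (Metric.ball_mem_nhds _ hr)).and
      (extChartAt_source_mem_nhds p)
  filter_upwards [h6] with q hq
  have := hconst _ hq.1
  rwa [Function.comp_apply, Function.comp_apply, (extChartAt I p).left_inv hq.2,
    extChartAt_to_inv] at this

variable [FiniteDimensional ℝ V]

/-- The 1-form in the chart at `x`, as a map to the dual space. -/
def OneForm.chartForm (α : OneForm I E) (x : E) (y : V) : V →L[ℝ] ℝ :=
  (α ((extChartAt I x).symm y)).comp
    (show V →L[ℝ] TangentSpace I ((extChartAt I x).symm y) from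
      mfderiv 𝓘(ℝ, V) I (extChartAt I x).symm y)

theorem OneForm.contDiffOn_chartForm (α : OneForm I E) (x : E) :
    ContDiffOn ℝ ∞ (α.chartForm I x) (extChartAt I x).target :=
  contDiffOn_clm_apply.2 fun v _ hy => (α.contDiffAt_inChart x v hy).contDiffWithinAt

/-- Every closed form has a smooth primitive on a chart ball. -/
theorem OneForm.IsClosed.exists_primitive {α : OneForm I E} (hα : OneForm.IsClosed I α) (x : E) :
    ∃ f : E → ℝ, ∀ p ∈ chartBall I x, ContMDiffAt I 𝓘(ℝ, ℝ) ∞ f p ∧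
      ∀ v : TangentSpace I p, α p v = mfderiv I 𝓘(ℝ, ℝ) f p v := by
  have hc := (α.contDiffOn_chartForm I x).mono (modelBall_subset I x)
  have hd : DifferentiableOn ℝ (α.chartForm I x) (modelBall I x) := hc.differentiableOn (by simp)
  have hda : ∀ y ∈ modelBall I x, DifferentiableAt ℝ (α.chartForm I x) y := fun y hy =>
    hd.differentiableAt ((isOpen_modelBall I x).mem_nhds hy)
  -- Poincaré lemma on a convex open set: closedness is the symmetry of the derivative of the chart
  -- form.
  obtain ⟨F, hF⟩ := (convex_modelBall I x).exists_forall_hasFDerivAt_of_fderiv_symmetric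
    (isOpen_modelBall I x) hd (by
      intro y hy u v
      have h := hα x y (modelBall_subset I x hy) u v
      have e : ∀ w w', fderiv ℝ (OneForm.inChart I α x w) y w' =
          fderiv ℝ (α.chartForm I x) y w' w := by
        intro w w'
        have : OneForm.inChart I α x w = fun z => α.chartForm I x z w := rfl
        rw [this, fderiv_clm_apply (hda y hy) (differentiableAt_const w)]
        simp
      rw [e, e] at h
      linarith)
  -- The derivative of `F` is the chart form, which is smooth.
  have hFs : ContDiffOn ℝ ∞ F (modelBall I x) := by
    rw [contDiffOn_infty_iff_fderiv_of_isOpen (isOpen_modelBall I x)]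
    refine ⟨fun y hy => (hF y hy).differentiableAt.differentiableWithinAt, hc.congr fun y hy => ?_⟩
    exact (hF y hy).fderiv
  refine ⟨F ∘ extChartAt I x, fun p hp => ?_⟩
  have hφ : ContMDiffAt I 𝓘(ℝ, V) ∞ (extChartAt I x) p :=
    contMDiffAt_extChartAt' (by simpa using hp.1)
  have hF' : ContMDiffAt 𝓘(ℝ, V) 𝓘(ℝ, ℝ) ∞ F (extChartAt I x p) :=
    (hFs.contDiffAt ((isOpen_modelBall I x).mem_nhds hp.2)).contMDiffAt
  refine ⟨hF'.comp p hφ, fun v => ?_⟩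
  rw [mfderiv_comp p (hF'.mdifferentiableAt (by simp)) (hφ.mdifferentiableAt (by simp)),
    mfderiv_eq_fderiv, (hF _ hp.2).fderiv]
  change α p v = α ((extChartAt I x).symm (extChartAt I x p))
    (mfderiv 𝓘(ℝ, V) I (extChartAt I x).symm (extChartAt I x p)
      (mfderiv I 𝓘(ℝ, V) (extChartAt I x) p v))
  rw [mfderiv_symm_comp_extChartAt I hp.1 v]
  -- The fibre containing `α p` depends on `p`, so the equality of base points is eliminated in
  -- general form.
  have : ∀ q : E, q = p → α p v = α q v := by rintro q rfl; rfl
  exact this _ ((extChartAt I x).left_inv hp.1)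

end ChartBall

end

noncomputable section

/-! ### Systems of primitives of a 1-form -/

/-- Chain rule with the derivative typed as a map on the model space, so that tangent spaces are
identified only here. -/
theorem exists_hasFDerivAt_comp {V H E W : Type*} [NormedAddCommGroup V] [NormedSpace ℝ V]
    [TopologicalSpace H] {I : ModelWithCorners ℝ V H} [TopologicalSpace E] [ChartedSpace H E]
    [NormedAddCommGroup W] [NormedSpace ℝ W] {f : E → ℝ} {c : W → E} {z : W}
    (hf : MDifferentiableAt I 𝓘(ℝ, ℝ) f (c z)) (hc : MDifferentiableAt 𝓘(ℝ, W) I c z) :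
    ∃ L : W →L[ℝ] ℝ, HasFDerivAt (f ∘ c) L z ∧
      ∀ v : W, L v = mfderiv I 𝓘(ℝ, ℝ) f (c z) (mfderiv 𝓘(ℝ, W) I c z v) :=
  ⟨_, (hf.hasMFDerivAt.comp z hc.hasMFDerivAt).hasFDerivAt, fun _ => rfl⟩

section PrimitiveSystemOf

variable {V : Type*} [NormedAddCommGroup V] [NormedSpace ℝ V]
  {H : Type*} [TopologicalSpace H] (I : ModelWithCorners ℝ V H)
  {E : Type u} [TopologicalSpace E] [ChartedSpace H E] [IsManifold I ∞ E]

/-- The functions of the system are smooth primitives of the 1-form. -/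
def PrimitiveSystem.IsPrimitiveOf (P : PrimitiveSystem E) (α : OneForm I E) : Prop :=
  ∀ x, ∀ p ∈ P.U x, ContMDiffAt I 𝓘(ℝ, ℝ) ∞ (P.f x) p ∧
    ∀ v : TangentSpace I p, α p v = mfderiv I 𝓘(ℝ, ℝ) (P.f x) p v

variable {I}

/-! ### Line integrals -/

/-- At the end points `F` may be anything, as happens at the corners of a path. On the open interval
it agrees with `derivWithin`, which is continuous up to the ends. -/
theorem intervalIntegrable_and_integral_eq_of_contDiffOn {G F : ℝ → ℝ} {a b : ℝ} (hab : a ≤ b)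
    (hG : ContDiffOn ℝ 1 G (Set.Icc a b)) (hF : ∀ t ∈ Set.Ioo a b, HasDerivAt G (F t) t) :
    IntervalIntegrable F MeasureTheory.volume a b ∧ ∫ t in a..b, F t = G b - G a := by
  rcases hab.eq_or_lt with rfl | hlt
  · simp
  have hint : IntervalIntegrable F MeasureTheory.volume a b := by
    have hc : ContinuousOn (derivWithin G (Set.Icc a b)) (Set.Icc a b) :=
      hG.continuousOn_derivWithin (uniqueDiffOn_Icc hlt) le_rfl
    have h1 : IntervalIntegrable (derivWithin G (Set.Icc a b)) MeasureTheory.volume a b :=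
      ContinuousOn.intervalIntegrable (by rwa [Set.uIcc_of_le hab])
    rw [intervalIntegrable_iff_integrableOn_Ioo_of_le hab] at h1 ⊢
    refine h1.congr_fun (fun t ht => ?_) measurableSet_Ioo
    exact (hF t ht).hasDerivWithinAt.derivWithin
      (uniqueDiffOn_Icc hlt t (Set.Ioo_subset_Icc_self ht))
  exact ⟨hint, intervalIntegral.integral_eq_sub_of_hasDerivAt_of_le hab hG.continuousOn hF hint⟩

/-- On every `C¹` piece a primitive along `γ` is locally `f ∘ γ` plus a constant, with derivative
`α(γ')`. The fundamental theorem of calculus applies to the pieces, and the increments telescope. -/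
theorem PrimitiveSystem.IsPrimitiveOf.lineIntegral_eq {P : PrimitiveSystem E}
    {α : OneForm I E} (hP : P.IsPrimitiveOf I α) {a b : E} {γ : Path a b}
    (hγ : IsPiecewiseC1 I γ) : lineIntegral I α γ = P.integral.val γ := by
  obtain ⟨n, t, ht, h0, h1, hC⟩ := hγ
  obtain ⟨g, hg⟩ := P.exists_isPrimitive_path γ.toContinuousMap
  let G : ℝ → ℝ := g ∘ Set.projIcc 0 1 zero_le_one
  have hG : P.IsPrimitive γ.extend G := hg.comp continuous_projIcc
  let F : ℝ → ℝ := fun s => α (γ.extend s) (mfderiv 𝓘(ℝ, ℝ) I γ.extend s (1 : ℝ))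
  have hev : ∀ s, G =ᶠ[𝓝 s] fun s' =>
      P.f (γ.extend s) (γ.extend s') + (G s - P.f (γ.extend s) (γ.extend s)) := by
    intro s
    filter_upwards [hG s (γ.extend s) (P.mem_U _)] with s' hs'
    linarith
  have piece : ∀ i < n, IntervalIntegrable F MeasureTheory.volume (t i) (t (i + 1)) ∧
      ∫ s in (t i)..(t (i + 1)), F s = G (t (i + 1)) - G (t i) := by
    intro i hi
    refine intervalIntegrable_and_integral_eq_of_contDiffOn (ht (Nat.le_succ i)) ?_ ?_
    · intro s hs
      have hf := ((hP _ _ (P.mem_U (γ.extend s))).1.of_le (m := 1) (by simp)).comp_contMDiffWithinAt s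
        (hC i hi s hs)
      have h2 := hf.contDiffWithinAt.add (contDiffWithinAt_const
        (c := G s - P.f (γ.extend s) (γ.extend s)))
      exact h2.congr_of_eventuallyEq ((hev s).filter_mono nhdsWithin_le_nhds) (hev s).self_of_nhds
    · intro s hs
      have hc : ContMDiffAt 𝓘(ℝ, ℝ) I 1 γ.extend s :=
        (hC i hi).contMDiffAt (Icc_mem_nhds hs.1 hs.2)
      have hf := (hP _ _ (P.mem_U (γ.extend s)))
      obtain ⟨L, h2, hL⟩ := exists_hasFDerivAt_comp (hf.1.mdifferentiableAt (by simp))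
        (hc.mdifferentiableAt (by simp))
      have h3 := (h2.hasDerivAt.add_const (G s - P.f (γ.extend s) (γ.extend s))).congr_of_eventuallyEq
        (hev s)
      exact h3.congr_deriv ((hf.2 _).trans (hL 1).symm).symm
  have hsum := intervalIntegral.sum_integral_adjacent_intervals (n := n) (f := F)
    (μ := MeasureTheory.volume) (a := t) (fun k hk => (piece k hk).1)
  rw [h0, h1] at hsum
  change ∫ s in (0 : ℝ)..1, F s = _
  rw [← hsum, Finset.sum_congr rfl fun i hi => (piece i (Finset.mem_range.1 hi)).2,
    Finset.sum_range_sub (fun i => G (t i)), h0, h1, PrimitiveSystem.integral_val_eq γ hg]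
  simp [G]

/-! ### The form of a smooth system of primitives -/

/-- Local primitives differing by locally constant functions have the same differential. At each `p`
it is taken from `f p`; near `x` it may be computed from the single smooth function `f x`. -/
theorem PrimitiveSystem.exists_oneForm (P : PrimitiveSystem E)
    (hP : ∀ x, ∀ p ∈ P.U x, ContMDiffAt I 𝓘(ℝ, ℝ) ∞ (P.f x) p) :
    ∃ α : OneForm I E, P.IsPrimitiveOf I α := by
  have hd : ∀ x, ∀ p ∈ P.U x, MDifferentiableAt I 𝓘(ℝ, ℝ) (P.f x) p :=
    fun x p hp => (hP x p hp).mdifferentiableAt (by simp)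
  have key : ∀ x, ∀ p ∈ P.U x, mfderiv I 𝓘(ℝ, ℝ) (P.f p) p = mfderiv I 𝓘(ℝ, ℝ) (P.f x) p := by
    intro x p hp
    have h1 := P.compat p x p (P.mem_U p) hp
    have h2 : P.f p =ᶠ[𝓝 p] P.f x + fun _ => (P.f p p - P.f x p) := by
      filter_upwards [h1] with z hz
      simp only [Pi.add_apply]
      linarith
    rw [h2.mfderiv_eq, mfderiv_add (hd x p hp) mdifferentiableAt_const, mfderiv_const]
    exact add_zero _
  let α₀ : ∀ p : E, TangentSpace I p →L[ℝ] ℝ := fun p => mfderiv I 𝓘(ℝ, ℝ) (P.f p) p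
  refine ⟨⟨α₀, fun x => ?_⟩, fun x p hp => ⟨hP x p hp, fun v => ?_⟩⟩
  · have h1 := ContMDiffAt.mfderiv_const (m := ∞) (hP x x (P.mem_U x)) (by simp)
    refine (contMDiffAt_hom_bundle (F₁ := V) (E₁ := fun p : E => TangentSpace I p) (F₂ := ℝ)
      (E₂ := Bundle.Trivial E ℝ) _).2 ⟨contMDiffAt_id, ?_⟩
    refine h1.congr_of_eventuallyEq ?_
    filter_upwards [(P.isOpen_U x).mem_nhds (P.mem_U x)] with q hq
    ext v
    simp [inTangentCoordinates, ContinuousLinearMap.inCoordinates, α₀, key x q hq]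
    rfl
  · exact DFunLike.congr_fun (key x p hp) v

/-! ### Forms and their systems of primitives -/

variable [I.Boundaryless]

variable (I) in
theorem eventually_sub_eq_of_mfderiv_eq {f g : E → ℝ} {p : E}
    (h : ∀ᶠ q in 𝓝 p, MDifferentiableAt I 𝓘(ℝ, ℝ) f q ∧ MDifferentiableAt I 𝓘(ℝ, ℝ) g q ∧
      mfderiv I 𝓘(ℝ, ℝ) f q = mfderiv I 𝓘(ℝ, ℝ) g q) :
    ∀ᶠ q in 𝓝 p, f q - g q = f p - g p := by
  refine eventually_eq_of_mfderiv_eq_zero I (f := f - g) ?_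
  filter_upwards [h] with q ⟨hf, hg, he⟩
  refine ⟨hf.sub hg, ?_⟩
  rw [mfderiv_sub hf hg]
  exact sub_eq_zero.2 he

theorem PrimitiveSystem.IsPrimitiveOf.eventually_sub_eq {P Q : PrimitiveSystem E}
    {α : OneForm I E} (hP : P.IsPrimitiveOf I α) (hQ : Q.IsPrimitiveOf I α) {x x' y : E}
    (hx : y ∈ P.U x) (hx' : y ∈ Q.U x') :
    ∀ᶠ z in 𝓝 y, P.f x z - Q.f x' z = P.f x y - Q.f x' y := by
  apply eventually_sub_eq_of_mfderiv_eq I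
  filter_upwards [(P.isOpen_U x).mem_nhds hx, (Q.isOpen_U x').mem_nhds hx'] with q hq hq'
  refine ⟨(hP x q hq).1.mdifferentiableAt (by simp), (hQ x' q hq').1.mdifferentiableAt (by simp), ?_⟩
  ext v
  exact ((hP x q hq).2 v).symm.trans ((hQ x' q hq').2 v)

/-- The domains are prescribed independently of the form, so that systems for several forms can be
added. -/
theorem OneForm.IsClosed.exists_primitiveSystem [FiniteDimensional ℝ V] {α : OneForm I E}
    (hα : OneForm.IsClosed I α) :
    ∃ P : PrimitiveSystem E, P.U = chartBall I ∧ P.IsPrimitiveOf I α := by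
  choose f hf using fun x => hα.exists_primitive I x
  refine ⟨⟨chartBall I, isOpen_chartBall I, mem_chartBall I, f, ?_⟩, rfl, hf⟩
  intro x x' y hx hx'
  apply eventually_sub_eq_of_mfderiv_eq I
  filter_upwards [(isOpen_chartBall I x).mem_nhds hx, (isOpen_chartBall I x').mem_nhds hx']
    with q hq hq'
  refine ⟨(hf x q hq).1.mdifferentiableAt (by simp), (hf x' q hq').1.mdifferentiableAt (by simp), ?_⟩
  ext v
  exact ((hf x q hq).2 v).symm.trans ((hf x' q hq').2 v)

/-- Primitives of the same form differ by locally constant functions, so a primitive along a path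
for one system serves the other. -/
theorem PrimitiveSystem.IsPrimitiveOf.integral_eq {P Q : PrimitiveSystem E}
    {α : OneForm I E} (hP : P.IsPrimitiveOf I α) (hQ : Q.IsPrimitiveOf I α) {a b : E}
    (p : Path a b) : P.integral.val p = Q.integral.val p := by
  obtain ⟨g, hg⟩ := P.exists_isPrimitive_path p.toContinuousMap
  have hg' : Q.IsPrimitive p g := by
    intro t x hx
    filter_upwards [hg t (p t) (P.mem_U _), p.continuous.continuousAt.eventually
      (hP.eventually_sub_eq hQ (P.mem_U (p t)) hx)] with t' h1 h2
    change g t' - P.f (p t) (p t') = g t - P.f (p t) (p t) at h1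
    linarith
  rw [PrimitiveSystem.integral_val_eq p hg, PrimitiveSystem.integral_val_eq p hg']

/-- In a chart the form is locally `dh`, and second derivatives are symmetric. -/
theorem PrimitiveSystem.IsPrimitiveOf.isClosed {P : PrimitiveSystem E}
    {α : OneForm I E} (hP : P.IsPrimitiveOf I α) : OneForm.IsClosed I α := by
  intro x y hy u v
  let p := (extChartAt I x).symm y
  let h : V → ℝ := P.f p ∘ (extChartAt I x).symm
  have hs := contMDiffAt_extChartAt_symm I hy
  have hh : ContDiffAt ℝ ∞ h y :=
    ContMDiffAt.contDiffAt (ContMDiffAt.comp y (hP p p (P.mem_U p)).1 hs)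
  have hev : ∀ w, OneForm.inChart I α x w =ᶠ[𝓝 y] fun z => fderiv ℝ h z w := by
    intro w
    filter_upwards [(isOpen_extChartAt_target x).mem_nhds hy,
      hs.continuousAt.preimage_mem_nhds ((P.isOpen_U p).mem_nhds (P.mem_U p))] with z hz hz'
    have h1 := hP p _ hz'
    obtain ⟨L, h2, hL⟩ := exists_hasFDerivAt_comp (h1.1.mdifferentiableAt (by simp))
      ((contMDiffAt_extChartAt_symm I hz).mdifferentiableAt (by simp))
    rw [h2.fderiv]
    exact (h1.2 _).trans (hL w).symm
  have hd : DifferentiableAt ℝ (fderiv ℝ h) y :=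
    (hh.fderiv_right (m := 1) (by norm_num; exact WithTop.coe_le_coe.2 (le_top : (2 : ℕ∞) ≤ ⊤))).differentiableAt (by simp)
  have e : ∀ w w', fderiv ℝ (OneForm.inChart I α x w) y w' = fderiv ℝ (fderiv ℝ h) y w' w := by
    intro w w'
    rw [(hev w).fderiv_eq, fderiv_clm_apply hd (differentiableAt_const w)]
    simp
  rw [e, e, sub_eq_zero]
  exact (hh.isSymmSndFDerivAt (by simp only [minSmoothness_of_isRCLikeNormedField]; exact WithTop.coe_le_coe.2 (le_top : (2 : ℕ∞) ≤ ⊤))).eq u v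

end PrimitiveSystemOf

end

noncomputable section

/-! ### Free coordinates on a finitely generated abelian group -/

/-- A split surjection of an abelian group onto a free group with kernel the torsion subgroup. -/
structure FreeCoordinates (A : Type*) [AddCommGroup A] (b : ℕ) where
  /-- The coordinates. -/
  coord : A →+ (Fin b → ℤ)
  /-- The splitting. -/
  lift : (Fin b → ℤ) →+ A
  coord_lift : ∀ n, coord (lift n) = n
  coord_eq_zero_iff : ∀ a, coord a = 0 ↔ a ∈ AddCommGroup.torsion A

namespace FreeCoordinates

/-- The quotient by torsion is finitely generated and torsion-free over `ℤ`, hence free of the same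
rank; being projective, it splits off. -/
theorem nonempty (A : Type*) [AddCommGroup A] (hA : AddGroup.FG A) :
    Nonempty (FreeCoordinates A (Module.finrank ℤ A)) := by
  have : Module.Finite ℤ A := Module.Finite.iff_addGroup_fg.2 hA
  have h : Module.finrank ℤ (A ⧸ Submodule.torsion ℤ A) = Module.finrank ℤ A :=
    finrank_quotient_eq_of_le_torsion le_rfl
  let b := Module.finBasisOfFinrankEq ℤ (A ⧸ Submodule.torsion ℤ A) h
  obtain ⟨s, hs⟩ := Module.projective_lifting_property (Submodule.torsion ℤ A).mkQ LinearMap.id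
    (Submodule.mkQ_surjective _)
  refine ⟨⟨(b.equivFun.toLinearMap ∘ₗ (Submodule.torsion ℤ A).mkQ).toAddMonoidHom,
    (s ∘ₗ b.equivFun.symm.toLinearMap).toAddMonoidHom, fun n => ?_, fun a => ?_⟩⟩
  · have := LinearMap.congr_fun hs (b.equivFun.symm n)
    simp only [LinearMap.comp_apply, LinearMap.id_apply] at this
    exact (congrArg b.equivFun this).trans (b.equivFun.apply_symm_apply n)
  · rw [← Submodule.torsion_int]
    simp

variable {A : Type*} [AddCommGroup A] {b : ℕ} (F : FreeCoordinates A b)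

/-- The lift of a standard basis vector. -/
def gen (j : Fin b) : A := F.lift (Pi.single j 1)

theorem coord_gen (j : Fin b) : F.coord (F.gen j) = Pi.single j 1 := F.coord_lift _

theorem sub_lift_mem (a : A) : a - F.lift (F.coord a) ∈ AddCommGroup.torsion A := by
  rw [← F.coord_eq_zero_iff, map_sub, F.coord_lift, sub_self]

/-- The projection onto the torsion subgroup. -/
def toTorsion : A →+ AddCommGroup.torsion A :=
  (AddMonoidHom.id A - F.lift.comp F.coord).codRestrict _ F.sub_lift_mem

theorem toTorsion_of_mem (a : AddCommGroup.torsion A) : F.toTorsion a = a := by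
  ext
  change (a : A) - F.lift (F.coord a) = a
  rw [(F.coord_eq_zero_iff a).2 a.2, map_zero, sub_zero]

/-- An element and the lift of its coordinates differ by torsion, which `ψ` kills. -/
theorem eq_sum_of_torsion_eq_zero {M : Type*} [AddCommGroup M] (ψ : A →+ M)
    (hψ : ∀ a ∈ AddCommGroup.torsion A, ψ a = 0) (a : A) :
    ψ a = ∑ j, F.coord a j • ψ (F.gen j) := by
  have h := hψ _ (F.sub_lift_mem a)
  rw [map_sub, sub_eq_zero] at h
  rw [h]
  conv_lhs => rw [← Finset.univ_sum_single (F.coord a)]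
  rw [map_sum, map_sum]
  refine Finset.sum_congr rfl fun j _ => ?_
  rw [gen, ← map_zsmul, ← map_zsmul, ← Pi.single_smul, smul_eq_mul, mul_one]

/-- A coordinate as a real homomorphism. -/
def realCoord (j : Fin b) : A →+ ℝ :=
  (Int.castAddHom ℝ).comp ((Pi.evalAddMonoidHom (fun _ => ℤ) j).comp F.coord)

theorem realCoord_apply (j : Fin b) (a : A) : F.realCoord j a = F.coord a j := rfl

theorem eq_sum_realCoord (ψ : A →+ ℝ) : ψ = ∑ j, ψ (F.gen j) • F.realCoord j := by
  ext a
  rw [F.eq_sum_of_torsion_eq_zero ψ ?_ a]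
  · simp [realCoord_apply, mul_comm]
  · intro a ha
    obtain ⟨n, hn, h⟩ := isOfFinAddOrder_iff_nsmul_eq_zero.1 (show IsOfFinAddOrder a from ha)
    have := congrArg ψ h
    rw [map_nsmul, map_zero, smul_eq_zero] at this
    exact this.resolve_left hn.ne'

/-- The coordinates form a basis of the real dual. -/
def realBasis : Module.Basis (Fin b) ℝ (A →+ ℝ) :=
  .ofEquivFun
    { toFun := fun ψ j => ψ (F.gen j)
      map_add' := fun _ _ => rfl
      map_smul' := fun _ _ => rfl
      invFun := fun c => ∑ j, c j • F.realCoord j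
      left_inv := fun ψ => (F.eq_sum_realCoord ψ).symm
      right_inv := fun c => by
        ext i
        simp [realCoord_apply, coord_gen, Pi.single_apply] }

theorem realBasis_apply (j : Fin b) : F.realBasis j = F.realCoord j := by
  simp [realBasis, Pi.single_apply]

end FreeCoordinates

theorem finite_torsion_of_fg {A : Type*} [AddCommGroup A] (hA : AddGroup.FG A) :
    Finite (AddCommGroup.torsion A) := by
  have : Module.Finite ℤ A := Module.Finite.iff_addGroup_fg.2 hA
  have : IsNoetherian ℤ A := inferInstance
  have h : Module.Finite ℤ (AddSubgroup.toIntSubmodule (AddCommGroup.torsion A)) := inferInstance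
  have h' : Module.Finite ℤ (AddCommGroup.torsion A) := h
  refine Module.finite_of_fg_torsion (AddCommGroup.torsion A) ?_
  rintro ⟨a, ha⟩
  obtain ⟨n, hn, h⟩ := isOfFinAddOrder_iff_nsmul_eq_zero.1 (show IsOfFinAddOrder a from ha)
  refine ⟨⟨(n : ℤ), mem_nonZeroDivisors_of_ne_zero (by exact_mod_cast hn.ne')⟩, ?_⟩
  ext
  simpa using h

/-! ### Characters -/

section Hurewicz

open SingularSimplex

variable {E : Type u} [TopologicalSpace E] {x₀ : E}

namespace Character

@[ext]
theorem ext {χ χ' : Character x₀} (h : ∀ g, χ g = χ' g) : χ = χ' :=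
  DFunLike.ext (F := FundamentalGroup E x₀ →* Circle) χ χ' h

theorem mul_apply (χ χ' : Character x₀) (g : FundamentalGroup E x₀) :
    (χ * χ') g = χ g * χ' g := rfl

theorem continuous_eval (g : FundamentalGroup E x₀) : Continuous fun χ : Character x₀ => χ g :=
  (continuous_apply g).comp continuous_induced_dom

theorem continuous_of_eval {T : Type*} [TopologicalSpace T] {f : T → Character x₀}
    (hf : ∀ g, Continuous fun t => f t g) : Continuous f :=
  continuous_induced_rng.2 (continuous_pi hf)

/-- The character obtained by exponentiating a real homomorphism. -/
def ofReal (x₀ : E) (η : H1 E →+ ℝ) : Character x₀ :=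
  show FundamentalGroup E x₀ →* Circle from
  { toFun := fun g => Circle.exp (η (hurewicz x₀ g).toAdd)
    map_one' := by rw [map_one, toAdd_one, map_zero, Circle.exp_zero]
    map_mul' := fun g g' => by rw [map_mul, toAdd_mul, map_add, Circle.exp_add] }

theorem ofReal_apply (η : H1 E →+ ℝ) (g : FundamentalGroup E x₀) :
    ofReal x₀ η g = Circle.exp (η (hurewicz x₀ g).toAdd) := rfl

/-- The curve `t ↦ exp(itη) χ` is pointwise continuous and starts at `χ`. -/
theorem ofReal_mul_mem_connectedComponent (η : H1 E →+ ℝ) (χ : Character x₀) :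
    ofReal x₀ η * χ ∈ connectedComponent χ := by
  have hc : Continuous fun t : ℝ => ofReal x₀ (t • η) * χ := by
    refine continuous_of_eval fun g => ?_
    simp only [mul_apply, ofReal_apply, AddMonoidHom.smul_apply, smul_eq_mul]
    fun_prop
  have h := (isPreconnected_range hc).subset_connectedComponent (x := χ) ⟨0, by
    ext g
    simp [mul_apply, ofReal_apply]⟩
  exact h ⟨1, by simp⟩

end Character

variable [PathConnectedSpace E]

/-- Homomorphisms of the fundamental group to a commutative group factor through homology. -/
def homH1 {M : Type*} [CommGroup M] (φ : FundamentalGroup E x₀ →* M) :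
    Multiplicative (H1 E) →* M :=
  (hurewicz x₀).liftOfSurjective (hurewicz_surjective x₀)
    ⟨φ, (hurewicz_ker x₀).trans (Abelianization.commutator_subset_ker φ)⟩

theorem homH1_hurewicz {M : Type*} [CommGroup M] (φ : FundamentalGroup E x₀ →* M)
    (g : FundamentalGroup E x₀) : homH1 φ (hurewicz x₀ g) = φ g :=
  (hurewicz x₀).liftOfRightInverse_comp_apply _ _ _ _

namespace Character

/-- A character as a character of the first homology. -/
def onH1 (χ : Character x₀) : Multiplicative (H1 E) →* Circle :=
  homH1 (show FundamentalGroup E x₀ →* Circle from χ)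

theorem onH1_hurewicz (χ : Character x₀) (g : FundamentalGroup E x₀) :
    onH1 χ (hurewicz x₀ g) = χ g :=
  homH1_hurewicz _ g

theorem onH1_mul (χ χ' : Character x₀) : onH1 (χ * χ') = onH1 χ * onH1 χ' := by
  refine MonoidHom.ext fun t => ?_
  obtain ⟨g, rfl⟩ := hurewicz_surjective x₀ t
  rw [MonoidHom.mul_apply, onH1_hurewicz, onH1_hurewicz, onH1_hurewicz, mul_apply]

/-- The restriction of a character to the torsion of the homology. -/
def torsionPart : Character x₀ →* (Multiplicative (TorsH1 E) →* Circle) :=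
  MonoidHom.mk' (fun χ => χ.onH1.comp (AddMonoidHom.toMultiplicative (TorsH1 E).subtype))
    fun χ χ' => by rw [onH1_mul]; rfl

theorem torsionPart_apply (χ : Character x₀) {t : Multiplicative (TorsH1 E)}
    {g : FundamentalGroup E x₀} (hg : hurewicz x₀ g = .ofAdd (t.toAdd : H1 E)) :
    torsionPart χ t = χ g := by
  rw [← onH1_hurewicz, hg]
  rfl

/-- A character of the torsion extends by composition with the projection along the free complement.
-/
theorem torsionPart_surjective {b : ℕ} (F : FreeCoordinates (H1 E) b) :
    Function.Surjective (torsionPart (x₀ := x₀)) := by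
  intro κ
  let χ : Character x₀ := κ.comp ((AddMonoidHom.toMultiplicative F.toTorsion).comp (hurewicz x₀))
  refine ⟨χ, ?_⟩
  refine MonoidHom.ext fun t => ?_
  obtain ⟨g, hg⟩ := hurewicz_surjective x₀ (.ofAdd (t.toAdd : H1 E))
  rw [torsionPart_apply χ hg]
  change κ (.ofAdd (F.toTorsion (hurewicz x₀ g).toAdd)) = _
  rw [hg, toAdd_ofAdd, F.toTorsion_of_mem]
  rfl

/-- On a class killed by `n`, every character takes values in the `n`-th roots of unity. This set is
finite, so the continuous evaluation is constant on a connected component. -/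
theorem torsionPart_eq_of_mem_connectedComponent {χ χ' : Character x₀}
    (h : χ ∈ connectedComponent χ') : torsionPart χ = torsionPart χ' := by
  refine MonoidHom.ext fun t => ?_
  obtain ⟨g, hg⟩ := hurewicz_surjective x₀ (.ofAdd (t.toAdd : H1 E))
  obtain ⟨n, hn, hnt⟩ := isOfFinAddOrder_iff_nsmul_eq_zero.1
    (show IsOfFinAddOrder (t.toAdd : H1 E) from t.toAdd.2)
  have : NeZero n := ⟨hn.ne'⟩
  let S : Set Circle := {z | z ^ n = 1}
  have hS : S.Finite := by
    have : S = (fun z : rootsOfUnity n Circle => ((z : Circleˣ) : Circle)) '' Set.univ := by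
      ext z
      refine ⟨fun hz => ⟨⟨toUnits z, ?_⟩, trivial, rfl⟩, ?_⟩
      · rw [mem_rootsOfUnity]
        ext1
        exact hz
      · rintro ⟨w, -, rfl⟩
        have := (mem_rootsOfUnity n _).1 w.2
        exact congrArg Units.val this
    rw [this]
    exact Set.toFinite _
  have hmap : ∀ ψ : Character x₀, ψ g ∈ S := by
    intro ψ
    change ψ g ^ n = 1
    rw [← onH1_hurewicz, hg, ← map_pow, ← ofAdd_nsmul, hnt]
    exact map_one _
  have hc := (isPreconnected_connectedComponent (x := χ')).constant_of_mapsTo hS.isDiscrete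
    (continuous_eval g).continuousOn (fun ψ _ => hmap ψ) h mem_connectedComponent
  rw [torsionPart_apply χ hg, torsionPart_apply χ' hg]
  exact hc

/-- The quotient of the two characters is trivial on torsion, hence determined on the free
generators; arguments of its values there define `η`. -/
theorem exists_eq_ofReal_mul {b : ℕ} (F : FreeCoordinates (H1 E) b) {χ χ' : Character x₀}
    (h : torsionPart χ = torsionPart χ') : ∃ η : H1 E →+ ℝ, χ = ofReal x₀ η * χ' := by
  let δ : H1 E →+ Additive Circle := MonoidHom.toAdditiveRight (onH1 (χ / χ'))
  have hδ : ∀ a ∈ AddCommGroup.torsion (H1 E), δ a = 0 := by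
    intro a ha
    have h1 : torsionPart (χ / χ') = 1 := by rw [map_div, h, div_self']
    exact DFunLike.congr_fun h1 (.ofAdd ⟨a, ha⟩)
  choose θ hθ using fun j => (⟨_, Circle.exp_arg _⟩ : ∃ θ, Circle.exp θ = (δ (F.gen j)).toMul)
  refine ⟨∑ j, θ j • F.realCoord j, ?_⟩
  rw [← div_eq_iff_eq_mul]
  refine Character.ext fun g => ?_
  have h2 : (χ / χ') g = (δ (hurewicz x₀ g).toAdd).toMul := (onH1_hurewicz _ g).symm
  rw [h2, F.eq_sum_of_torsion_eq_zero δ hδ, ofReal_apply, toMul_sum]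
  have h3 : ∀ j, (F.coord (hurewicz x₀ g).toAdd j • δ (F.gen j)).toMul =
      Circle.exp (θ j * F.realCoord j (hurewicz x₀ g).toAdd) := by
    intro j
    rw [toMul_zsmul, ← hθ, ← Circle.exp_zsmul, F.realCoord_apply, zsmul_eq_mul, mul_comm]
  rw [Finset.prod_congr rfl fun j _ => h3 j]
  have h4 := map_sum Circle.expHom (fun j => θ j * F.realCoord j (hurewicz x₀ g).toAdd) Finset.univ
  rw [AddMonoidHom.finsetSum_apply]
  exact congrArg (fun z : Additive Circle => z.toMul) h4.symm

end Character

/-- The components of the character group are indexed by the torsion of the homology. -/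
theorem exists_component_hom (hE : AddGroup.FG (H1 E)) (x₀ : E) :
    ∃ p : Character x₀ →* Multiplicative (TorsH1 E), Function.Surjective p ∧
      ∀ χ χ' : Character x₀, p χ = p χ' ↔ connectedComponent χ = connectedComponent χ' := by
  obtain ⟨F⟩ := FreeCoordinates.nonempty (H1 E) hE
  have := finite_torsion_of_fg hE
  have : NeZero (Monoid.exponent (Multiplicative (TorsH1 E))) := inferInstance
  -- A finite abelian group is non-canonically isomorphic to its dual, since the circle contains all
  -- roots of unity.
  obtain ⟨e⟩ := CommGroup.monoidHom_mulEquiv_of_hasEnoughRootsOfUnity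
    (Multiplicative (TorsH1 E)) Circle
  let e' : (Multiplicative (TorsH1 E) →* Circle) ≃* Multiplicative (TorsH1 E) :=
    (MulEquiv.monoidHomCongrRight toUnits).trans e
  refine ⟨e'.toMonoidHom.comp Character.torsionPart,
    e'.surjective.comp (Character.torsionPart_surjective F), fun χ χ' => ?_⟩
  change e' _ = e' _ ↔ _
  rw [e'.injective.eq_iff]
  constructor
  · intro h
    obtain ⟨η, rfl⟩ := Character.exists_eq_ofReal_mul F h
    exact (connectedComponent_eq (Character.ofReal_mul_mem_connectedComponent η χ')).symm
  · intro h
    exact Character.torsionPart_eq_of_mem_connectedComponent (h ▸ mem_connectedComponent)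

end Hurewicz

end

noncomputable section

/-! ### Periods of closed forms -/

theorem locallyPathConnectedSpace_of_boundaryless {V : Type*} [NormedAddCommGroup V]
    [NormedSpace ℝ V] {H : Type*} [TopologicalSpace H] (I : ModelWithCorners ℝ V H) [I.Boundaryless]
    (E : Type*) [TopologicalSpace E] [ChartedSpace H E] : LocallyPathConnectedSpace E := by
  have : LocallyPathConnectedSpace H := I.toHomeomorph.isOpenEmbedding.locallyPathConnectedSpace
  exact ChartedSpace.locallyPathConnectedSpace H E

theorem pathConnectedSpace_of_connectedSpace {V : Type*} [NormedAddCommGroup V] [NormedSpace ℝ V]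
    {H : Type*} [TopologicalSpace H] (I : ModelWithCorners ℝ V H) [I.Boundaryless]
    (E : Type*) [TopologicalSpace E] [ChartedSpace H E] [ConnectedSpace E] :
    PathConnectedSpace E := by
  have := locallyPathConnectedSpace_of_boundaryless I E
  exact pathConnectedSpace_iff_connectedSpace.2 inferInstance

section Periods

variable {V : Type*} [NormedAddCommGroup V] [NormedSpace ℝ V]
  {H : Type*} [TopologicalSpace H] (I : ModelWithCorners ℝ V H) [I.Boundaryless]
  {E : Type u} [TopologicalSpace E] [ChartedSpace H E] [IsManifold I ∞ E] [FiniteDimensional ℝ V]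

/-- Integration of a closed form along paths. -/
def periodCocycle (α : closedForms I E) : PathCocycle E ℝ :=
  (OneForm.IsClosed.exists_primitiveSystem α.2).choose.integral

theorem periodCocycle_val_eq {α : closedForms I E} {P : PrimitiveSystem E}
    (hP : P.IsPrimitiveOf I (α : OneForm I E)) {a b : E} (p : Path a b) :
    (periodCocycle I α).val p = P.integral.val p :=
  (OneForm.IsClosed.exists_primitiveSystem α.2).choose_spec.2.integral_eq hP p

theorem lineIntegral_eq_periodCocycle (α : closedForms I E) {a b : E} {γ : Path a b}
    (hγ : IsPiecewiseC1 I γ) :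
    lineIntegral I (α : OneForm I E) γ = (periodCocycle I α).val γ :=
  (OneForm.IsClosed.exists_primitiveSystem α.2).choose_spec.2.lineIntegral_eq hγ

theorem periodCocycle_add (α β : closedForms I E) {a b : E} (p : Path a b) :
    (periodCocycle I (α + β)).val p = (periodCocycle I α).val p + (periodCocycle I β).val p := by
  obtain ⟨P, hPU, hP⟩ := OneForm.IsClosed.exists_primitiveSystem α.2
  obtain ⟨Q, hQU, hQ⟩ := OneForm.IsClosed.exists_primitiveSystem β.2
  let R : PrimitiveSystem E := ⟨chartBall I, isOpen_chartBall I, mem_chartBall I, P.f + Q.f, by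
    intro x x' y hx hx'
    filter_upwards [P.compat x x' y (hPU ▸ hx) (hPU ▸ hx'), Q.compat x x' y (hQU ▸ hx) (hQU ▸ hx')]
      with z h1 h2
    simp only [Pi.add_apply]
    linarith⟩
  have hR : R.IsPrimitiveOf I ((α + β : closedForms I E) : OneForm I E) := by
    intro x p hp
    have h1 := hP x p (hPU ▸ hp)
    have h2 := hQ x p (hQU ▸ hp)
    refine ⟨h1.1.add h2.1, fun v => ?_⟩
    change _ = mfderiv I 𝓘(ℝ, ℝ) (P.f x + Q.f x) p v
    rw [mfderiv_add (h1.1.mdifferentiableAt (by simp)) (h2.1.mdifferentiableAt (by simp))]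
    exact congrArg₂ (· + ·) (h1.2 v) (h2.2 v)
  obtain ⟨g, hg⟩ := P.exists_isPrimitive_path p.toContinuousMap
  obtain ⟨g', hg'⟩ := Q.exists_isPrimitive_path p.toContinuousMap
  have hgg : R.IsPrimitive p (g + g') := by
    intro t x hx
    filter_upwards [hg t x (hPU ▸ hx), hg' t x (hQU ▸ hx)] with t' h1 h2
    simp only [R, Pi.add_apply, Path.coe_toContinuousMap] at h1 h2 ⊢
    linarith
  rw [periodCocycle_val_eq I hR, periodCocycle_val_eq I hP, periodCocycle_val_eq I hQ,
    PrimitiveSystem.integral_val_eq p hg, PrimitiveSystem.integral_val_eq p hg',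
    PrimitiveSystem.integral_val_eq p hgg]
  simp only [Pi.add_apply]
  ring

set_option synthInstance.maxHeartbeats 200000 in
theorem periodCocycle_smul (c : ℝ) (α : closedForms I E) {a b : E} (p : Path a b) :
    (periodCocycle I (c • α)).val p = c * (periodCocycle I α).val p := by
  obtain ⟨P, hPU, hP⟩ := OneForm.IsClosed.exists_primitiveSystem α.2
  let R : PrimitiveSystem E := ⟨chartBall I, isOpen_chartBall I, mem_chartBall I, c • P.f, by
    intro x x' y hx hx'
    filter_upwards [P.compat x x' y (hPU ▸ hx) (hPU ▸ hx')] with z h1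
    simp only [Pi.smul_apply, smul_eq_mul, ← mul_sub, h1]⟩
  have hR : R.IsPrimitiveOf I ((c • α : closedForms I E) : OneForm I E) := by
    intro x p hp
    have h1 := hP x p (hPU ▸ hp)
    have h3 : ContMDiffAt I 𝓘(ℝ, ℝ) ∞ (fun q => c • P.f x q) p :=
      (contMDiffAt_const (c := c)).mul h1.1
    refine ⟨h3, fun v => ?_⟩
    change _ = mfderiv I 𝓘(ℝ, ℝ) (c • P.f x) p v
    rw [const_smul_mfderiv (h1.1.mdifferentiableAt (by simp))]
    exact congrArg (c * ·) (h1.2 v)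
  obtain ⟨g, hg⟩ := P.exists_isPrimitive_path p.toContinuousMap
  have hgg : R.IsPrimitive p (c • g) := by
    intro t x hx
    filter_upwards [hg t x (hPU ▸ hx)] with t' h1
    simp only [R, Pi.smul_apply, smul_eq_mul, ← mul_sub, Path.coe_toContinuousMap] at h1 ⊢
    rw [h1]
  rw [periodCocycle_val_eq I hR, periodCocycle_val_eq I hP,
    PrimitiveSystem.integral_val_eq p hg, PrimitiveSystem.integral_val_eq p hgg]
  simp only [Pi.smul_apply, smul_eq_mul]
  ring

variable [PathConnectedSpace E]

open SingularSimplex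

theorem exists_loop_of_H1 (x₀ : E) (a : H1 E) :
    ∃ γ : Path x₀ x₀, (hurewicz x₀ (loopClass γ)).toAdd = a := by
  obtain ⟨g, hg⟩ := hurewicz_surjective x₀ (.ofAdd a)
  obtain ⟨γ, rfl⟩ := loopClass_surjective g
  exact ⟨γ, congrArg Multiplicative.toAdd hg⟩

/-- The homomorphism on homology induced by a cocycle. -/
def PathCocycle.onH1 (Φ : PathCocycle E ℝ) (x₀ : E) : H1 E →+ ℝ :=
  AddMonoidHom.toMultiplicative.symm (homH1 (Φ.toHom x₀))

theorem PathCocycle.onH1_hurewicz (Φ : PathCocycle E ℝ) {x₀ : E} (γ : Path x₀ x₀) :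
    Φ.onH1 x₀ (hurewicz x₀ (loopClass γ)).toAdd = Φ.val γ :=
  congrArg Multiplicative.toAdd (homH1_hurewicz (Φ.toHom x₀) (loopClass γ))

/-- The periods of a closed form. -/
def period (x₀ : E) : closedForms I E →ₗ[ℝ] (H1 E →+ ℝ) where
  toFun α := (periodCocycle I α).onH1 x₀
  map_add' α β := by
    ext a
    obtain ⟨γ, rfl⟩ := exists_loop_of_H1 x₀ a
    rw [AddMonoidHom.add_apply, PathCocycle.onH1_hurewicz, PathCocycle.onH1_hurewicz,
      PathCocycle.onH1_hurewicz, periodCocycle_add]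
  map_smul' c α := by
    ext a
    obtain ⟨γ, rfl⟩ := exists_loop_of_H1 x₀ a
    rw [AddMonoidHom.smul_apply, PathCocycle.onH1_hurewicz, PathCocycle.onH1_hurewicz,
      periodCocycle_smul]
    rfl

theorem period_hurewicz {x₀ : E} (α : closedForms I E) (γ : Path x₀ x₀) :
    period I x₀ α (hurewicz x₀ (loopClass γ)).toAdd = (periodCocycle I α).val γ :=
  PathCocycle.onH1_hurewicz _ γ

/-- A global primitive is a system with the whole space as domain, and its increment along a loop is
zero. -/
theorem period_eq_zero_of_isExact (x₀ : E) {α : closedForms I E} (hα : α ∈ exactForms I E) :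
    period I x₀ α = 0 := by
  obtain ⟨f, hf, hfα⟩ := hα
  let P : PrimitiveSystem E := ⟨fun _ => Set.univ, fun _ => isOpen_univ, fun _ => trivial,
    fun _ => f, fun _ _ _ _ _ => by simp⟩
  have hP : P.IsPrimitiveOf I (α : OneForm I E) := fun x p _ => ⟨hf p, hfα p⟩
  ext a
  obtain ⟨γ, rfl⟩ := exists_loop_of_H1 x₀ a
  rw [period_hurewicz, periodCocycle_val_eq I hP,
    P.integral_val_of_mem (x := x₀) γ fun _ => trivial]
  exact sub_self _

/-- Integrate from `x₀` along chosen paths. Vanishing periods make the result independent of the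
path, so near `x` it is the local primitive plus a constant, hence smooth. -/
theorem isExact_of_period_eq_zero {x₀ : E} {α : closedForms I E} (hα : period I x₀ α = 0) :
    α ∈ exactForms I E := by
  obtain ⟨P, hPU, hP⟩ := OneForm.IsClosed.exists_primitiveSystem α.2
  have hloop : ∀ γ : Path x₀ x₀, P.integral.val γ = 0 := by
    intro γ
    rw [← periodCocycle_val_eq I hP, ← period_hurewicz, hα]
    rfl
  let F : E → ℝ := fun y => P.integral.val (PathConnectedSpace.somePath x₀ y)
  have hF : ∀ {a b : E} (p : Path a b), P.integral.val p = F b - F a := by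
    intro a b p
    have := hloop (((PathConnectedSpace.somePath x₀ a).trans p).trans
      (PathConnectedSpace.somePath x₀ b).symm)
    rw [P.integral.val_trans, P.integral.val_trans, P.integral.val_symm] at this
    simp only [F]
    linarith
  have hloc : ∀ x, F =ᶠ[𝓝 x] P.f x + fun _ => (F x - P.f x x) := by
    intro x
    filter_upwards [(isOpen_chartBall I x).mem_nhds (mem_chartBall I x)] with y hy
    have h1 := P.integral_val_of_mem (x := x) (chartSegment I (mem_chartBall I x) hy)
      fun t => hPU ▸ chartSegment_mem I (mem_chartBall I x) hy t
    rw [hF] at h1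
    simp only [Pi.add_apply]
    linarith
  refine ⟨F, fun x => ?_, fun x v => ?_⟩
  · exact ((hP x x (P.mem_U x)).1.add contMDiffAt_const).congr_of_eventuallyEq (hloc x)
  · have h := hP x x (P.mem_U x)
    rw [(hloc x).mfderiv_eq, mfderiv_add (h.1.mdifferentiableAt (by simp))
      mdifferentiableAt_const, mfderiv_const]
    exact (h.2 v).trans (add_zero _).symm

theorem ker_period (x₀ : E) : LinearMap.ker (period I (E := E) x₀) = exactForms I E := by
  ext α
  exact ⟨isExact_of_period_eq_zero I, period_eq_zero_of_isExact I x₀⟩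

end Periods

end

noncomputable section

/-! ### Closed forms with prescribed periods -/

section PrescribedPeriods

variable {V : Type*} [NormedAddCommGroup V] [NormedSpace ℝ V]
  {H : Type*} [TopologicalSpace H] (I : ModelWithCorners ℝ V H) [I.Boundaryless]
  {E : Type u} [TopologicalSpace E] [ChartedSpace H E]

namespace PathCocycle

variable (Φ : PathCocycle E ℝ)

open Classical in
/-- The value of a cocycle on the segments from the centre of a chart ball. -/
def radial (x y : E) : ℝ :=
  if h : y ∈ chartBall I x then Φ.val (chartSegment I (mem_chartBall I x) h) else 0

/-- Inside the ball, the segment to `a` followed by `p` is homotopic to the segment to `b`. -/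
theorem val_eq_radial_sub {x a b : E} (p : Path a b) (hp : ∀ t, p t ∈ chartBall I x) :
    Φ.val p = Φ.radial I x b - Φ.radial I x a := by
  have ha : a ∈ chartBall I x := by simpa using hp 0
  have hb : b ∈ chartBall I x := by simpa using hp 1
  rw [radial, radial, dif_pos ha, dif_pos hb, eq_sub_iff_add_eq', ← Φ.val_trans]
  refine Φ.val_congr (homotopic_of_mem_chartBall I _ _ (fun t => ?_) (chartSegment_mem I _ _))
  have : ((chartSegment I (mem_chartBall I x) ha).trans p) t ∈
      Set.range ((chartSegment I (mem_chartBall I x) ha).trans p) := ⟨t, rfl⟩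
  rw [Path.trans_range] at this
  rcases this with ⟨s, hs⟩ | ⟨s, hs⟩
  · exact hs ▸ chartSegment_mem I _ _ s
  · exact hs ▸ hp s

/-- On a path-connected neighbourhood inside both balls, the two radial functions have the same
increment, namely `Φ` of a joining path. Neither need be continuous by itself. -/
theorem eventually_radial_sub_eq {x x' y : E} (hx : y ∈ chartBall I x) (hx' : y ∈ chartBall I x') :
    ∀ᶠ z in 𝓝 y, Φ.radial I x z - Φ.radial I x' z = Φ.radial I x y - Φ.radial I x' y := by
  have := locallyPathConnectedSpace_of_boundaryless I E
  obtain ⟨W, ⟨hW, hWc⟩, hWs⟩ := (path_connected_basis y).mem_iff.1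
    (((isOpen_chartBall I x).inter (isOpen_chartBall I x')).mem_nhds ⟨hx, hx'⟩)
  filter_upwards [hW] with z hz
  obtain ⟨p, hp⟩ := hWc.joinedIn y (mem_of_mem_nhds hW) z hz
  have h1 := Φ.val_eq_radial_sub I (x := x) p fun t => (hWs (hp t)).1
  have h2 := Φ.val_eq_radial_sub I (x := x') p fun t => (hWs (hp t)).2
  linarith

variable [IsManifold I ∞ E] [FiniteDimensional ℝ V] [T2Space E] [SigmaCompactSpace E]

/-- Up to a coboundary, every real cocycle is integration of a closed form. -/
theorem exists_closedForm : ∃ (α : closedForms I E) (G : E → ℝ), ∀ {a b : E} (p : Path a b),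
    (periodCocycle I α).val p = Φ.val p - (G b - G a) := by
  obtain ⟨ρ, hρ⟩ := SmoothPartitionOfUnity.exists_isSubordinate I (isClosed_univ (X := E))
    (chartBall I) (isOpen_chartBall I) fun x _ => Set.mem_iUnion_of_mem x (mem_chartBall I x)
  -- The average of the radial functions; subtracting it leaves a locally finite sum of differences
  -- with smooth weights.
  let G : E → ℝ := fun y => ∑ᶠ i, ρ i y • Φ.radial I i y
  have hsum : ∀ x y, Φ.radial I x y - G y =
      ∑ᶠ i, ρ i y • (Φ.radial I x y - Φ.radial I i y) := by
    intro x y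
    have hfin : (Function.support fun i => ρ i y).Finite := ρ.locallyFinite.point_finite y
    have h1 : ∀ v : E → ℝ, (Function.support fun i => ρ i y • v i).Finite := fun v =>
      hfin.subset (Function.support_smul_subset_left (fun i => ρ i y) v)
    have h2 := finsum_smul (fun i => ρ i y) (Φ.radial I x y)
    rw [ρ.sum_eq_one (Set.mem_univ y), one_smul] at h2
    simp only [smul_sub]
    rw [finsum_sub_distrib (h1 fun _ => Φ.radial I x y) (h1 fun i => Φ.radial I i y), ← h2]
  let P : PrimitiveSystem E := ⟨chartBall I, isOpen_chartBall I, mem_chartBall I,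
    fun x y => Φ.radial I x y - G y, by
      intro x x' y hx hx'
      filter_upwards [Φ.eventually_radial_sub_eq I hx hx'] with z hz
      linarith⟩
  have hsmooth : ∀ x, ∀ p ∈ P.U x, ContMDiffAt I 𝓘(ℝ, ℝ) ∞ (P.f x) p := by
    intro x p hp
    have h1 : P.f x = fun y => ∑ᶠ i, ρ i y • (Φ.radial I x y - Φ.radial I i y) :=
      funext (hsum x)
    rw [h1]
    refine ρ.contMDiffAt_finsum fun i hi => ?_
    -- Wherever the weight `ρ i` matters, the point lies in both balls and the difference is locally
    -- constant.
    exact contMDiffAt_const.congr_of_eventuallyEq (Φ.eventually_radial_sub_eq I hp (hρ i hi))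
  obtain ⟨α, hα⟩ := P.exists_oneForm hsmooth
  refine ⟨⟨α, hα.isClosed⟩, G, fun p => ?_⟩
  -- `Φ` minus the coboundary of `G`; on paths inside a ball it is the increment of the corrected
  -- primitive.
  let Ψ : PathCocycle E ℝ :=
    { val := fun {a b} p => Φ.val p - (G b - G a)
      val_congr := fun h => by rw [Φ.val_congr h]
      val_trans := fun p q => by rw [Φ.val_trans]; ring }
  rw [periodCocycle_val_eq I (α := ⟨α, hα.isClosed⟩) hα]
  refine P.integral_val_eq_of_local Ψ (fun x a b p hp => ?_) p
  change Φ.val p - (G b - G a) = (Φ.radial I x b - G b) - (Φ.radial I x a - G a)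
  rw [Φ.val_eq_radial_sub I p hp]
  ring

end PathCocycle

open SingularSimplex

/-- The coboundary of `G` vanishes on loops, so the form produced from the cocycle of `η` has
periods `η`. -/
theorem period_surjective [IsManifold I ∞ E] [FiniteDimensional ℝ V] [T2Space E]
    [SigmaCompactSpace E] [PathConnectedSpace E] (x₀ : E) :
    Function.Surjective (period I x₀) := by
  intro η
  let φ : FundamentalGroup E x₀ →* Multiplicative ℝ :=
    (AddMonoidHom.toMultiplicative η).comp (hurewicz x₀)
  obtain ⟨α, G, hα⟩ := (PathCocycle.ofHom φ).exists_closedForm I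
  refine ⟨α, ?_⟩
  ext a
  obtain ⟨γ, rfl⟩ := exists_loop_of_H1 x₀ a
  rw [period_hurewicz, hα, PathCocycle.ofHom_val_loop, sub_self, sub_zero]
  rfl

/-- The de Rham theorem in degree one. -/
def deRhamEquiv [IsManifold I ∞ E] [FiniteDimensional ℝ V] [T2Space E]
    [SigmaCompactSpace E] [PathConnectedSpace E] (x₀ : E) : DeRhamH1 I E ≃ₗ[ℝ] (H1 E →+ ℝ) :=
  (Submodule.quotEquivOfEq _ _ (ker_period I x₀).symm).trans
    ((period I x₀).quotKerEquivOfSurjective (period_surjective I x₀))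

end PrescribedPeriods

/-! ### Piecewise smooth representatives -/

section PiecewiseC1

variable {V : Type*} [NormedAddCommGroup V] [NormedSpace ℝ V]
  {H : Type*} [TopologicalSpace H] (I : ModelWithCorners ℝ V H)
  {E : Type u} [TopologicalSpace E] [ChartedSpace H E]

variable {I} in
theorem IsPiecewiseC1.cast {a b a' b' : E} {γ : Path a b} (h : IsPiecewiseC1 I γ) (ha : a' = a)
    (hb : b' = b) : IsPiecewiseC1 I (γ.cast ha hb) := by
  subst ha hb
  exact h

theorem Path.trans_extend_of_le {X : Type*} [TopologicalSpace X] {a b c : X} (p : Path a b)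
    (q : Path b c) {t : ℝ} (ht : t ∈ Set.Icc (0 : ℝ) (1 / 2)) :
    (p.trans q).extend t = p.extend (2 * t) := by
  have ht1 : t ∈ Set.Icc (0 : ℝ) 1 := ⟨ht.1, by linarith [ht.2]⟩
  rw [Path.extend_apply _ ht1]
  have h2 : t ≤ 2⁻¹ := by linarith [ht.2]
  simp [Path.trans, h2]

theorem Path.trans_extend_of_ge {X : Type*} [TopologicalSpace X] {a b c : X} (p : Path a b)
    (q : Path b c) {t : ℝ} (ht : t ∈ Set.Icc (1 / 2 : ℝ) 1) :
    (p.trans q).extend t = q.extend (2 * t - 1) := by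
  rcases ht.1.eq_or_lt with rfl | hlt
  · rw [Path.trans_extend_of_le _ _ ⟨by norm_num, le_rfl⟩]
    norm_num
  have ht1 : t ∈ Set.Icc (0 : ℝ) 1 := ⟨by linarith [ht.1], ht.2⟩
  rw [Path.extend_apply _ ht1]
  have h2 : ¬ t ≤ 2⁻¹ := by linarith
  simp [Path.trans, h2]

variable {I} in
theorem IsPiecewiseC1.trans {a b c : E} {p : Path a b} {q : Path b c} (hp : IsPiecewiseC1 I p)
    (hq : IsPiecewiseC1 I q) : IsPiecewiseC1 I (p.trans q) := by
  obtain ⟨n, t, ht, ht0, ht1, hC⟩ := hp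
  obtain ⟨m, s, hs, hs0, hs1, hD⟩ := hq
  have htn : ∀ i ≤ n, t i ∈ Set.Icc (0 : ℝ) 1 := fun i hi =>
    ⟨ht0 ▸ ht (Nat.zero_le i), ht1 ▸ ht hi⟩
  have hsn : ∀ i ≤ m, s i ∈ Set.Icc (0 : ℝ) 1 := fun i hi =>
    ⟨hs0 ▸ hs (Nat.zero_le i), hs1 ▸ hs hi⟩
  -- The two subdivisions, halved and put side by side; both formulas give `1/2` at the shared index
  -- `n`.
  let r : ℕ → ℝ := fun i => if i ≤ n then t i / 2 else (1 + s (i - n)) / 2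
  have hr1 : ∀ i ≤ n, r i = t i / 2 := fun i hi => if_pos hi
  have hr2 : ∀ i, r (n + i) = (1 + s i) / 2 := by
    intro i
    rcases Nat.eq_zero_or_pos i with rfl | hi
    · rw [add_zero, hr1 n le_rfl, ht1, hs0, add_zero]
    · simp only [r]
      rw [if_neg (by omega), Nat.add_sub_cancel_left]
  refine ⟨n + m, r, monotone_nat_of_le_succ fun i => ?_, ?_, ?_, fun i hi => ?_⟩
  · rcases lt_or_ge i n with h | h
    · rw [hr1 i h.le, hr1 (i + 1) h]
      linarith [ht (Nat.le_succ i)]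
    · obtain ⟨j, rfl⟩ := Nat.exists_eq_add_of_le h
      rw [add_assoc, hr2, hr2]
      linarith [hs (Nat.le_succ j)]
  · rw [hr1 0 (Nat.zero_le n), ht0, zero_div]
  · rw [hr2, hs1]
    norm_num
  · rcases lt_or_ge i n with h | h
    · rw [hr1 i h.le, hr1 (i + 1) h]
      have hc : ContMDiff 𝓘(ℝ, ℝ) 𝓘(ℝ, ℝ) 1 fun u : ℝ => 2 * u :=
        (contDiff_const.mul contDiff_id).contMDiff
      refine ((hC i h).comp hc.contMDiffOn fun u hu => ?_).congr fun u hu => ?_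
      · exact ⟨by linarith [hu.1], by linarith [hu.2]⟩
      · exact Path.trans_extend_of_le p q
          ⟨by linarith [hu.1, (htn i h.le).1], by linarith [hu.2, (htn (i + 1) h).2]⟩
    · obtain ⟨j, rfl⟩ := Nat.exists_eq_add_of_le h
      have hj : j < m := by omega
      rw [add_assoc, hr2, hr2]
      have hc : ContMDiff 𝓘(ℝ, ℝ) 𝓘(ℝ, ℝ) 1 fun u : ℝ => 2 * u - 1 :=
        ((contDiff_const.mul contDiff_id).sub contDiff_const).contMDiff
      refine ((hD j hj).comp hc.contMDiffOn fun u hu => ?_).congr fun u hu => ?_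
      · exact ⟨by linarith [hu.1], by linarith [hu.2]⟩
      · exact Path.trans_extend_of_ge p q
          ⟨by linarith [hu.1, (hsn j hj.le).1], by linarith [hu.2, (hsn (j + 1) hj).2]⟩

variable [I.Boundaryless] [IsManifold I ∞ E]

theorem isPiecewiseC1_chartSegment {x a b : E} (ha : a ∈ chartBall I x) (hb : b ∈ chartBall I x) :
    IsPiecewiseC1 I (chartSegment I ha hb) := by
  refine ⟨1, fun n => if n = 0 then 0 else 1, monotone_nat_of_le_succ fun i => ?_, by simp, by simp,
    fun i hi => ?_⟩
  · by_cases h : i = 0 <;> simp [h]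
  · obtain rfl : i = 0 := by omega
    have hc : ContMDiff 𝓘(ℝ, ℝ) 𝓘(ℝ, V) 1
        (AffineMap.lineMap (extChartAt I x a) (extChartAt I x b) : ℝ → V) :=
      (AffineMap.contDiff_lineMap _ _).contMDiff
    have hs := ((contMDiffOn_extChartAt_symm (I := I) (n := ∞) x).of_le (m := 1) (by simp)).comp
      (hc.contMDiffOn (s := Set.Icc (0 : ℝ) 1)) fun t ht =>
        modelBall_subset I x (exists_lineMap_mem_modelBall I ha hb ht)
    simp only [↓reduceIte, zero_add, one_ne_zero]
    exact hs.congr fun t ht => by rw [Path.extend_apply _ ht]; rfl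

/-- Consider the times `t` for which the initial part of `γ` up to `t` is homotopic to a piecewise
`C¹` path. Appending a chart segment shows that this condition is locally constant in `t`; it holds
at `0`, hence at `1`. -/
theorem exists_isPiecewiseC1_homotopic {a b : E} (γ : Path a b) :
    ∃ q : Path a b, IsPiecewiseC1 I q ∧ q.Homotopic γ := by
  let S : unitInterval → Prop := fun t =>
    ∃ q : Path (γ 0) (γ t), IsPiecewiseC1 I q ∧ q.Homotopic (γ.subpath 0 t)
  have hS : IsLocallyConstant S := by
    rw [IsLocallyConstant.iff_eventually_eq]
    intro t
    have hnhds : γ ⁻¹' chartBall I (γ t) ∈ 𝓝 t := γ.continuous.continuousAt.preimage_mem_nhds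
      ((isOpen_chartBall I _).mem_nhds (mem_chartBall I _))
    obtain ⟨l, u, ht, hN, hsub⟩ := exists_Icc_mem_subset_of_mem_nhds hnhds
    have key : ∀ s ∈ Set.Icc l u, ∀ s' ∈ Set.Icc l u, S s → S s' := by
      rintro s hs s' hs' ⟨q, hq, hh⟩
      refine ⟨q.trans (chartSegment I (hsub hs) (hsub hs')),
        hq.trans (isPiecewiseC1_chartSegment I _ _), ?_⟩
      refine (hh.hcomp (homotopic_of_mem_chartBall I (x := γ t) _ (γ.subpath s s')
        (chartSegment_mem I _ _) fun r => ?_)).trans ⟨Path.Homotopy.subpathTransSubpath γ 0 s s'⟩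
      have : (γ.subpath s s') r ∈ Set.range (γ.subpath s s') := ⟨r, rfl⟩
      rw [Path.range_subpath] at this
      obtain ⟨r', hr', hr⟩ := this
      rw [← hr]
      exact hsub (Set.uIcc_subset_Icc hs hs' hr')
    filter_upwards [hN] with s hs
    exact propext ⟨key s hs t ht, key t ht s hs⟩
  have h0 : S 0 := ⟨chartSegment I (mem_chartBall I _) (mem_chartBall I _),
    isPiecewiseC1_chartSegment I _ _, homotopic_of_mem_chartBall I _ _ (chartSegment_mem I _ _)
      fun t => by simpa using mem_chartBall I (γ 0)⟩
  obtain ⟨q, hq, hh⟩ : S 1 := (hS.apply_eq_of_preconnectedSpace 0 1) ▸ h0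
  rw [Path.subpath_zero_one] at hh
  refine ⟨q.cast γ.source.symm γ.target.symm, hq.cast _ _, ?_⟩
  exact hh.pathCast _ _

theorem exists_isPiecewiseC1_loopClass_eq {x₀ : E} (g : FundamentalGroup E x₀) :
    ∃ γ : Path x₀ x₀, IsPiecewiseC1 I γ ∧ loopClass γ = g := by
  obtain ⟨γ, rfl⟩ := loopClass_surjective g
  obtain ⟨q, hq, hh⟩ := exists_isPiecewiseC1_homotopic I γ
  exact ⟨q, hq, loopClass_congr hh⟩

end PiecewiseC1

end

noncomputable section

/-! ### The form of the characters -/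

theorem LinearMap.map_fintype_linearCombination {R W W' ι : Type*} [Semiring R] [AddCommMonoid W]
    [AddCommMonoid W'] [Module R W] [Module R W'] [Fintype ι] (f : W →ₗ[R] W') (w : ι → W)
    (c : ι → R) : f (Fintype.linearCombination R w c) = ∑ j, c j • f (w j) := by
  simp [Fintype.linearCombination_apply]

theorem LinearEquiv.eq_sum_zsmul_iff {R W W' ι : Type*} [Semiring R] [AddCommGroup W]
    [AddCommGroup W'] [Module R W] [Module R W'] [Fintype ι] (e : W ≃ₗ[R] W') (v : W) (w : ι → W)
    (m : ι → ℤ) : v = ∑ j, m j • w j ↔ e v = ∑ j, m j • e (w j) := by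
  rw [← e.injective.eq_iff]
  simp

theorem LinearEquiv.exists_sum_smul_eq {R W W' ι : Type*} [Semiring R] [AddCommMonoid W]
    [AddCommMonoid W'] [Module R W] [Module R W'] [Fintype ι] (e : W ≃ₗ[R] W') {w : ι → W}
    (hw : Submodule.span R (Set.range w) = ⊤) (v : W') : ∃ a : ι → R, ∑ j, a j • e (w j) = v := by
  have h : e.symm v ∈ Submodule.span R (Set.range w) := hw ▸ trivial
  rw [← Fintype.range_linearCombination] at h
  obtain ⟨a, ha⟩ := h
  exact ⟨a, (e.toLinearMap.map_fintype_linearCombination w a).symm.trans (e.eq_symm_apply.1 ha)⟩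

section CharacterForms

open SingularSimplex

namespace Character

variable {E : Type u} [TopologicalSpace E] [PathConnectedSpace E] {x₀ : E}

theorem ofReal_eq_iff (η η' : H1 E →+ ℝ) :
    ofReal x₀ η = ofReal x₀ η' ↔ ∀ a, ∃ m : ℤ, η a = η' a + m * (2 * Real.pi) := by
  constructor
  · intro h a
    obtain ⟨g, hg⟩ := hurewicz_surjective x₀ (.ofAdd a)
    have h1 := DFunLike.congr_fun h g
    rw [ofReal_apply, ofReal_apply, hg] at h1
    exact Circle.exp_eq_exp.1 h1
  · intro h
    refine Character.ext fun g => ?_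
    rw [ofReal_apply, ofReal_apply]
    exact Circle.exp_eq_exp.2 (h _)

end Character

variable {V : Type*} [NormedAddCommGroup V] [NormedSpace ℝ V] [FiniteDimensional ℝ V]
  {H : Type*} [TopologicalSpace H] (I : ModelWithCorners ℝ V H) [I.Boundaryless]
  {E : Type u} [TopologicalSpace E] [ChartedSpace H E] [IsManifold I ∞ E]
  [PathConnectedSpace E]

/-- Piecewise `C¹` loops represent all classes, so (∗) becomes an identity in the character group
that determines `χ`. -/
theorem hasForm_iff (ħ : ℝ) {b : ℕ} (α : Fin b → closedForms I E) {x₀ : E} (χ ψ : Character x₀)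
    (a : Fin b → ℝ) : HasForm I ħ α χ a ψ ↔
      χ = Character.ofReal x₀ (ħ⁻¹ • ∑ j, a j • period I x₀ (α j)) * ψ := by
  have key : ∀ γ : Path x₀ x₀, IsPiecewiseC1 I γ →
      Complex.exp (Complex.I / (ħ : ℂ) *
        ((∑ j, a j * lineIntegral I (α j : OneForm I E) γ : ℝ) : ℂ)) * (ψ (loopClass γ) : ℂ) =
      ((Character.ofReal x₀ (ħ⁻¹ • ∑ j, a j • period I x₀ (α j)) * ψ) (loopClass γ) : Circle) := by
    intro γ hγ
    rw [Character.mul_apply, Circle.coe_mul, Character.ofReal_apply, Circle.coe_exp]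
    congr 2
    simp only [AddMonoidHom.smul_apply, AddMonoidHom.finsetSum_apply, period_hurewicz,
      lineIntegral_eq_periodCocycle I _ hγ, smul_eq_mul]
    push_cast
    ring
  constructor
  · intro h
    refine Character.ext fun g => ?_
    obtain ⟨γ, hγ, rfl⟩ := exists_isPiecewiseC1_loopClass_eq I g
    exact Circle.ext ((h γ hγ).trans (key γ hγ))
  · intro h γ hγ
    rw [key γ hγ, ← h]

/-- Conjugating a loop by a path from `x₀` does not change its integral, so loops at `x₀` suffice.
-/
theorem integral_lineIntegral_iff (ħ : ℝ) (x₀ : E) (β : closedForms I E) :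
    (∀ (x : E) (γ : Path x x), IsPiecewiseC1 I γ →
      ∃ m : ℤ, lineIntegral I (β : OneForm I E) γ = ħ * m) ↔
    ∀ a, ∃ m : ℤ, period I x₀ β a = ħ * m := by
  constructor
  · intro h a
    obtain ⟨g, hg⟩ := hurewicz_surjective x₀ (.ofAdd a)
    obtain ⟨γ, hγ, rfl⟩ := exists_isPiecewiseC1_loopClass_eq I g
    obtain ⟨m, hm⟩ := h x₀ γ hγ
    refine ⟨m, ?_⟩
    rw [← hm, lineIntegral_eq_periodCocycle I β hγ, ← period_hurewicz, hg]
    rfl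
  · intro h x γ hγ
    let p := PathConnectedSpace.somePath x₀ x
    obtain ⟨m, hm⟩ := h (hurewicz x₀ (loopClass ((p.trans γ).trans p.symm))).toAdd
    refine ⟨m, ?_⟩
    rw [period_hurewicz, PathCocycle.val_trans, PathCocycle.val_trans, PathCocycle.val_symm] at hm
    rw [lineIntegral_eq_periodCocycle I β hγ, ← hm]
    ring

/-- The characters agree iff the form with coefficients `(a' - a) / 2π` has periods in `ħℤ`. By
normalisation its class is then an integral combination of the basis, and linear independence makes
those coefficients integers. -/
theorem IsNormalized.ofReal_eq_iff {ħ : ℝ} (hħ : ħ ≠ 0) {b : ℕ} {α : Fin b → closedForms I E}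
    (hli : LinearIndependent ℝ (fun j => (exactForms I E).mkQ (α j)))
    (hα : IsNormalized I ħ α) (x₀ : E) (a a' : Fin b → ℝ) :
    Character.ofReal x₀ (ħ⁻¹ • ∑ j, a' j • period I x₀ (α j)) =
      Character.ofReal x₀ (ħ⁻¹ • ∑ j, a j • period I x₀ (α j)) ↔
    ∀ j, ∃ m : ℤ, a' j = a j + 2 * Real.pi * m := by
  have hpi : (2 * Real.pi) ≠ 0 := by positivity
  let c : Fin b → ℝ := fun j => (2 * Real.pi)⁻¹ * (a' j - a j)
  let β : closedForms I E := Fintype.linearCombination ℝ α c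
  have hβ : ∀ x, period I x₀ β x = ħ * ((2 * Real.pi)⁻¹ *
      ((ħ⁻¹ • ∑ j, a' j • period I x₀ (α j)) x - (ħ⁻¹ • ∑ j, a j • period I x₀ (α j)) x)) := by
    intro x
    simp only [β, c, LinearMap.map_fintype_linearCombination, AddMonoidHom.smul_apply,
      AddMonoidHom.finsetSum_apply, smul_eq_mul]
    rw [← mul_sub, ← Finset.sum_sub_distrib, mul_left_comm _ ħ⁻¹, mul_inv_cancel_left₀ hħ,
      Finset.mul_sum]
    exact Finset.sum_congr rfl fun j _ => by ring
  have h1 : (∀ x, ∃ m : ℤ, (ħ⁻¹ • ∑ j, a' j • period I x₀ (α j)) x =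
      (ħ⁻¹ • ∑ j, a j • period I x₀ (α j)) x + m * (2 * Real.pi)) ↔
      ∀ x, ∃ m : ℤ, period I x₀ β x = ħ * m := by
    refine forall_congr' fun x => exists_congr fun m => ?_
    rw [hβ, mul_right_inj' hħ, inv_mul_eq_iff_eq_mul₀ hpi, sub_eq_iff_eq_add', mul_comm (m : ℝ)]
  rw [Character.ofReal_eq_iff, h1, ← integral_lineIntegral_iff, hα β, Classical.skolem]
  refine exists_congr fun m => ?_
  have h2 : (exactForms I E).mkQ β = ∑ j, c j • (exactForms I E).mkQ (α j) :=
    (exactForms I E).mkQ.map_fintype_linearCombination α c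
  have h3 : ∑ j, m j • (exactForms I E).mkQ (α j) =
      ∑ j, (m j : ℝ) • (exactForms I E).mkQ (α j) := by
    simp only [Int.cast_smul_eq_zsmul]
  rw [h2, h3, ← sub_eq_zero, ← Finset.sum_sub_distrib]
  simp only [← sub_smul]
  constructor
  · intro h j
    have h4 := Fintype.linearIndependent_iff.1 hli _ h j
    simp only [c] at h4
    rw [sub_eq_zero, inv_mul_eq_iff_eq_mul₀ hpi] at h4
    linarith
  · intro h
    refine Finset.sum_eq_zero fun j _ => ?_
    have : c j - m j = 0 := by
      simp only [c]
      rw [h j, sub_eq_zero, inv_mul_eq_iff_eq_mul₀ hpi]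
      ring
    rw [this, zero_smul]

variable [T2Space E] [SigmaCompactSpace E]

theorem mkQ_eq_sum_iff {b : ℕ} (α : Fin b → closedForms I E) (x₀ : E) (β : closedForms I E)
    (m : Fin b → ℤ) : (exactForms I E).mkQ β = ∑ j, m j • (exactForms I E).mkQ (α j) ↔
      period I x₀ β = ∑ j, m j • period I x₀ (α j) :=
  (deRhamEquiv I x₀).eq_sum_zsmul_iff _ _ m

/-- Take forms whose periods are `ħ` times the integral coordinates of `H₁`. The coefficients of a
class are then its periods on the free generators divided by `ħ`. -/
theorem exists_normalized {b : ℕ} (F : FreeCoordinates (H1 E) b) (x₀ : E) {ħ : ℝ} (hħ : ħ ≠ 0) :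
    ∃ α : Fin b → closedForms I E,
      LinearIndependent ℝ (fun j => (exactForms I E).mkQ (α j)) ∧
      Submodule.span ℝ (Set.range fun j => (exactForms I E).mkQ (α j)) = ⊤ ∧
      IsNormalized I ħ α := by
  choose α hα using fun j => period_surjective I x₀ (ħ • F.realCoord j)
  let B : Module.Basis (Fin b) ℝ (DeRhamH1 I E) :=
    (F.realBasis.unitsSMul fun _ => Units.mk0 ħ hħ).map (deRhamEquiv I x₀).symm
  have hB : (fun j => (exactForms I E).mkQ (α j)) = B := by
    funext j
    have hBj : B j = (deRhamEquiv I x₀).symm (ħ • F.realCoord j) := by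
      rw [Module.Basis.map_apply, Module.Basis.unitsSMul_apply, F.realBasis_apply]
      rfl
    exact ((deRhamEquiv I x₀).eq_symm_apply.2 (hα j)).trans hBj.symm
  refine ⟨α, hB ▸ B.linearIndependent, hB ▸ B.span_eq, fun β => ?_⟩
  rw [integral_lineIntegral_iff I ħ x₀ β]
  simp only [mkQ_eq_sum_iff I α x₀, hα]
  constructor
  · intro h
    choose m hm using fun j => h (F.gen j)
    refine ⟨m, ?_⟩
    rw [F.eq_sum_realCoord (period I x₀ β)]
    refine Finset.sum_congr rfl fun j _ => ?_
    rw [hm]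
    ext a
    simp only [AddMonoidHom.smul_apply, smul_eq_mul, zsmul_eq_mul]
    ring
  · rintro ⟨m, hm⟩ a
    refine ⟨∑ j, m j * F.coord a j, ?_⟩
    rw [hm, AddMonoidHom.finsetSum_apply]
    push_cast
    rw [Finset.mul_sum]
    refine Finset.sum_congr rfl fun j _ => ?_
    change m j • (ħ * (F.coord a j : ℝ)) = _
    rw [zsmul_eq_mul]
    ring

theorem exists_coefficients {b : ℕ} {α : Fin b → closedForms I E}
    (hspan : Submodule.span ℝ (Set.range fun j => (exactForms I E).mkQ (α j)) = ⊤) (x₀ : E)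
    (η : H1 E →+ ℝ) : ∃ a : Fin b → ℝ, ∑ j, a j • period I x₀ (α j) = η :=
  (deRhamEquiv I x₀).exists_sum_smul_eq hspan η

end CharacterForms

end

/-! ### The main theorem. -/

theorem mainTheorem1 {V : Type*} [NormedAddCommGroup V] [NormedSpace ℝ V] [FiniteDimensional ℝ V]
    {H : Type*} [TopologicalSpace H] (I : ModelWithCorners ℝ V H) [I.Boundaryless]
    (E : Type u) [TopologicalSpace E] [ChartedSpace H E] [IsManifold I ∞ E]
    [T2Space E] [SecondCountableTopology E] [ConnectedSpace E]
    (hE : AddGroup.FG (H1 E)) (x₀ : E) (ħ : ℝ) (hħ : 0 < ħ) :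
    -- the components of the character group form a group isomorphic to the torsion of `H₁(E, ℤ)`
    (∃ p : Character x₀ →* Multiplicative (TorsH1 E), Function.Surjective p ∧
      ∀ χ χ' : Character x₀, p χ = p χ' ↔ connectedComponent χ = connectedComponent χ') ∧
    -- `b₁` is the dimension of the first de Rham cohomology
    Module.Finite ℝ (DeRhamH1 I E) ∧ Module.finrank ℝ (DeRhamH1 I E) = firstBetti E ∧
    -- every homotopy class of loops has a piecewise `C¹` representative
    (∀ g : FundamentalGroup E x₀, ∃ γ : Path x₀ x₀, IsPiecewiseC1 I γ ∧ loopClass γ = g) ∧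
    -- there is a normalised basis of the first de Rham cohomology
    (∃ α : Fin (firstBetti E) → closedForms I E,
      LinearIndependent ℝ (fun j => (exactForms I E).mkQ (α j)) ∧
      Submodule.span ℝ (Set.range fun j => (exactForms I E).mkQ (α j)) = ⊤ ∧
      IsNormalized I ħ α) ∧
    -- for every basis of the first de Rham cohomology ...
    ∀ α : Fin (firstBetti E) → closedForms I E,
      LinearIndependent ℝ (fun j => (exactForms I E).mkQ (α j)) →
      Submodule.span ℝ (Set.range fun j => (exactForms I E).mkQ (α j)) = ⊤ →
      -- ... and every choice of one character in each component, labelled by the torsion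
      ∀ rep : TorsH1 E → Character x₀,
        (∀ χ : Character x₀, ∃! k, χ ∈ connectedComponent (rep k)) →
        (∀ χ : Character x₀, ∃ k, ∃ a : Fin (firstBetti E) → ℝ, HasForm I ħ α χ a (rep k)) ∧
        (∀ k (a : Fin (firstBetti E) → ℝ), ∃! χ : Character x₀, HasForm I ħ α χ a (rep k)) ∧
        (∀ χ k (a : Fin (firstBetti E) → ℝ), HasForm I ħ α χ a (rep k) →
          χ ∈ connectedComponent (rep k)) ∧
        (IsNormalized I ħ α → ∀ χ k (a a' : Fin (firstBetti E) → ℝ), HasForm I ħ α χ a (rep k) →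
          (HasForm I ħ α χ a' (rep k) ↔ ∀ j, ∃ m : ℤ, a' j = a j + 2 * Real.pi * m)) := by
  have := pathConnectedSpace_of_connectedSpace I E
  -- Local compactness and second countability give σ-compactness, needed for partitions of unity.
  have : LocallyCompactSpace H := I.locallyCompactSpace
  have : LocallyCompactSpace E := ChartedSpace.locallyCompactSpace H E
  obtain ⟨F⟩ : Nonempty (FreeCoordinates (H1 E) (firstBetti E)) := FreeCoordinates.nonempty _ hE
  let B := F.realBasis.map (deRhamEquiv I x₀).symm
  refine ⟨exists_component_hom hE x₀, .of_basis B, ?_, exists_isPiecewiseC1_loopClass_eq I,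
    exists_normalized I F x₀ hħ.ne', fun α hli hspan rep hrep => ?_⟩
  · rw [Module.finrank_eq_card_basis B, Fintype.card_fin]
  · simp only [hasForm_iff]
    refine ⟨fun χ => ?_, fun k a => ⟨_, rfl, fun _ h => h⟩, ?_, ?_⟩
    · obtain ⟨k, hk, -⟩ := hrep χ
      obtain ⟨η, hη⟩ := Character.exists_eq_ofReal_mul F
        (Character.torsionPart_eq_of_mem_connectedComponent hk)
      -- The factor `ħ` compensates the `ħ⁻¹` in the exponent of (∗).
      obtain ⟨a, ha⟩ := exists_coefficients I hspan x₀ (ħ • η)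
      exact ⟨k, a, by rw [ha, inv_smul_smul₀ hħ.ne', hη]⟩
    · rintro χ k a rfl
      exact Character.ofReal_mul_mem_connectedComponent _ _
    · rintro hα χ k a a' rfl
      rw [mul_left_inj, eq_comm]
      exact hα.ofReal_eq_iff I hħ.ne' hli x₀ a a'
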